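/- Let $\kappa$ be a strongly inaccessible cardinal (uncountable, regular, strong limit), let $\mathbb A$ be a set of atoms with $|\mathbb A|=\kappa$, and let $r:\mathbb R\hookrightarrow\mathbb A$ be an injection, by which $\mathbb R$ is regarded as a subset of $\mathbb A$. For a set $X$ put $V_0(X)=X$, $V_{n+1}(X)=V_n(X)\cup\wp(V_n(X))$ and $V(X)=\bigcup_n V_n(X)$. Let $\Lambda$ be the collection of all $X\in V(\mathbb A)$ that are hereditarily of cardinality $<\kappa$ (that is, $X$, its elements, the elements of its elements, and so on, all have fewer than $\kappa$ elements; atoms have none). Let $\Lambda_S$ be the collection of sets in $\Lambda$, so that $\Lambda=\Lambda_S\cup\mathbb A$, and let $\mathfrak L$ be the collection of finite sets in $\Lambda$. Ordered pairs are Kuratowski pairs. For $n_0\in\mathbb N$ and $\lambda_0\in\mathfrak L$ let $Q(n_0,\lambda_0)=\{V_n(\lambda)\in\mathfrak L : n\ge n_0,\ \lambda\in\mathfrak L,\ \lambda\supseteq\lambda_0\}$. Call an ultrafilter $\mathcal U$ over $\mathfrak L$ admissible if $Q(n,\lambda)\in\mathcal U$ for all $n\in\mathbb N$ and $\lambda\in\mathfrak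 L$, and if also the family of all $\lambda\in\mathfrak L$ such that $(a,b)\in\lambda$ implies $a,b\in\lambda$ belongs to $\mathcal U$. For a field $K$ let $\mathfrak F(\mathfrak L,K)$ be the ring of all nets $\varphi:\mathfrak L\to K$ for which there is $B\in\Lambda_S$ with $\varphi(\lambda)=\varphi(\lambda\cap B)$ for all $\lambda\in\mathfrak L$, and let $I_K$ be the ideal of those nets that vanish on some member of $\mathcal U$. A tower over $\mathcal U$ consists of ordered fields $\mathbb K_j\subseteq\mathbb A$ ($j\le\kappa$), with $\mathbb K_i$ an ordered subfield of $\mathbb K_j$ for $i\le j$, of injective maps $\Theta_j:\mathfrak F(\mathfrak L,\mathbb K_j)/I_{\mathbb K_j}\to\mathbb A$ ($j<\kappa$), and of a map $J:\mathfrak F(\mathfrak L,\mathbb K_\kappa)\to\mathbb K_\kappa$, such that, with $J_j(\varphi)=\Theta_j(\varphi+I_{\mathbb K_j})$: * $\mathbb K_0=\mathbb R$ as an ordered field; * $\Theta_j$ is a ring isomorphism onto $\mathbb K_{j+1}$, and $J_j(\varphi)\le J_j(\psi)$ if and only if $\{\lambda:\varphi(\lambda)\le\psi(\lambda)\}\in\mathcal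 U$; * $J_0$ maps the constant net with value $x\in\mathbb R$ to $x$, and $J_j$ extends $J_i$ for $i\le j<\kappa$; * $\mathbb K_k=\bigcup_{j<k}\mathbb K_j$ for every limit ordinal $k\le\kappa$; * $J$ is the direct limit of the $J_j$: $J(\varphi)=J_j(\varphi)$ whenever $j<\kappa$ and $\varphi\in\mathfrak F(\mathfrak L,\mathbb K_j)$. For $A\in\Lambda_S$ set $\mathfrak{num}(A)=J(\lambda\mapsto|\lambda\cap A|)\in\mathbb K_\kappa\subseteq\mathbb A$, and let $\mathfrak N=\mathfrak{num}(\Lambda_S)\subseteq\mathbb A$ be ordered as a subset of $\mathbb K_\kappa$. **Theorem.** Admissible ultrafilters exist, over every admissible ultrafilter there is a tower, and for every tower over an admissible ultrafilter the map $\mathfrak{num}:\Lambda_S\to\mathfrak N$ satisfies the Numerosity Axiom: it is surjective onto $\mathfrak N\subseteq\mathbb A$ and, for all $a,b\in\Lambda$ and $A,B,A',B'\in\Lambda_S$, 1. $\mathfrak{num}(\{a\})=\mathfrak{num}(\{b\})$; 2. if $A\subsetneq B$ then $\mathfrak{num}(A)<\mathfrak{num}(B)$; 3. if $A\cap B=\varnothing=A'\cap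 B'$, $\mathfrak{num}(A)=\mathfrak{num}(A')$ and $\mathfrak{num}(B)=\mathfrak{num}(B')$, then $\mathfrak{num}(A\cup B)=\mathfrak{num}(A'\cup B')$; 4. if $\mathfrak{num}(A)=\mathfrak{num}(A')$ and $\mathfrak{num}(B)=\mathfrak{num}(B')$, then $\mathfrak{num}(A\times B)=\mathfrak{num}(A'\times B')$; 5. $\mathfrak{num}(A\times\{b\})=\mathfrak{num}(A)$. Moreover, in the field $\mathbb K_\kappa$, $\mathfrak{num}(A\cup B)=\mathfrak{num}(A)+\mathfrak{num}(B)$ whenever $A\cap B=\varnothing$, and $\mathfrak{num}(A\times B)=\mathfrak{num}(A)\cdot\mathfrak{num}(B)$. -/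

import Mathlib

universe u

namespace EuclideanUniverse

/-! ### Sets over a type of atoms

`Obj A` is the class of all sets-with-atoms whose atoms are the elements of `A`:
well-founded trees modulo extensional equality. -/

/-- Codes for hereditary sets over atoms: either an atom, or a small family of codes. -/
inductive PreObj (A : Type u) : Type (u + 1)
  | atom (a : A) : PreObj A
  | fam (ι : Type u) (f : ι → PreObj A) : PreObj A

/-- Extensional equality of codes. -/
def PreObj.Equiv {A : Type u} : PreObj A → PreObj A → Prop
  | .atom a, .atom b => a = b
  | .fam _ f, .fam _ g => (∀ i, ∃ j, PreObj.Equiv (f i) (g j)) ∧ ∀ j, ∃ i, PreObj.Equiv (f i) (g j)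
  | .atom _, .fam _ _ => False
  | .fam _ _, .atom _ => False

theorem PreObj.Equiv.refl {A : Type u} (x : PreObj A) : PreObj.Equiv x x := by
  induction x with
  | atom a => simp [PreObj.Equiv]
  | fam ι f ih => exact ⟨fun i => ⟨i, ih i⟩, fun i => ⟨i, ih i⟩⟩

theorem PreObj.Equiv.symm {A : Type u} {x y : PreObj A} (h : PreObj.Equiv x y) :
    PreObj.Equiv y x := by
  induction x generalizing y with
  | atom a => cases y <;> simp_all [PreObj.Equiv]
  | fam ι f ih =>
    cases y with
    | atom b => exact h
    | fam ι' g =>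
      refine ⟨fun j => ?_, fun i => ?_⟩
      · obtain ⟨i, hi⟩ := h.2 j
        exact ⟨i, ih i hi⟩
      · obtain ⟨j, hj⟩ := h.1 i
        exact ⟨j, ih i hj⟩

theorem PreObj.Equiv.trans {A : Type u} {x y z : PreObj A} (h : PreObj.Equiv x y)
    (h' : PreObj.Equiv y z) : PreObj.Equiv x z := by
  induction x generalizing y z with
  | atom a => cases y <;> cases z <;> simp_all [PreObj.Equiv]
  | fam ι f ih =>
    cases y with
    | atom b => exact h.elim
    | fam ι' g =>
      cases z with
      | atom c => exact h'.elim
      | fam ι'' k =>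
        refine ⟨fun i => ?_, fun l => ?_⟩
        · obtain ⟨j, hj⟩ := h.1 i
          obtain ⟨l, hl⟩ := h'.1 j
          exact ⟨l, ih i hj hl⟩
        · obtain ⟨j, hj⟩ := h'.2 l
          obtain ⟨i, hi⟩ := h.2 j
          exact ⟨i, ih i hi hj⟩

instance PreObj.setoid (A : Type u) : Setoid (PreObj A) :=
  ⟨PreObj.Equiv, PreObj.Equiv.refl, PreObj.Equiv.symm, PreObj.Equiv.trans⟩

/-- The objects: atoms (elements of `A`) and sets over the atoms. -/
def Obj (A : Type u) : Type (u + 1) := Quotient (PreObj.setoid A)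

variable {A : Type u}

/-- The atom `a`, as an object. -/
def atom (a : A) : Obj A := Quotient.mk _ (.atom a)

/-- The object `x` is a set (not an atom). -/
def IsSet (x : Obj A) : Prop := ∀ a : A, x ≠ atom a

/-- The elements of a code; atoms have none. -/
def PreObj.elems : PreObj A → Set (Obj A)
  | .atom _ => ∅
  | .fam _ f => Set.range fun i => (Quotient.mk _ (f i) : Obj A)

theorem PreObj.elems_congr {x y : PreObj A} (h : PreObj.Equiv x y) : x.elems = y.elems := by
  cases x with
  | atom a => cases y with
    | atom b => rfl
    | fam _ _ => exact h.elim
  | fam ι f => cases y with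
    | atom b => exact h.elim
    | fam ι' g =>
      ext z
      constructor
      · rintro ⟨i, rfl⟩
        obtain ⟨j, hj⟩ := h.1 i
        exact ⟨j, Quotient.sound hj.symm⟩
      · rintro ⟨j, rfl⟩
        obtain ⟨i, hi⟩ := h.2 j
        exact ⟨i, Quotient.sound hi⟩

/-- The elements of an object (no elements if it is an atom). -/
def ext (x : Obj A) : Set (Obj A) :=
  Quotient.lift PreObj.elems (fun _ _ h => PreObj.elems_congr h) x

instance small_ext (x : Obj A) : Small.{u} (ext x) := by
  induction x using Quotient.inductionOn with
  | h p =>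
    cases p with
    | atom a => exact (inferInstance : Small.{u} (∅ : Set (Obj A)))
    | fam ι f => exact small_range (fun i => (Quotient.mk _ (f i) : Obj A))

/-- A code of an object. -/
noncomputable def Obj.code (x : Obj A) : PreObj A := Quotient.out x

theorem Obj.mk_code (x : Obj A) : (Quotient.mk _ x.code : Obj A) = x := Quotient.out_eq x

/-- The set whose elements are those of the small collection `S`. -/
noncomputable def mkSet (S : Set (Obj A)) [Small.{u} S] : Obj A :=
  Quotient.mk _ (.fam (Shrink.{u} S) fun i => ((equivShrink S).symm i : Obj A).code)

theorem ext_mkSet (S : Set (Obj A)) [Small.{u} S] : ext (mkSet S) = S := by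
  ext z
  change z ∈ Set.range _ ↔ _
  constructor
  · rintro ⟨i, rfl⟩
    change (Quotient.mk _ ((equivShrink S).symm i : Obj A).code : Obj A) ∈ S
    rw [Obj.mk_code]
    exact ((equivShrink S).symm i).2
  · intro hz
    refine ⟨equivShrink S ⟨z, hz⟩, ?_⟩
    change (Quotient.mk _ ((equivShrink S).symm (equivShrink S ⟨z, hz⟩) : Obj A).code : Obj A) = z
    rw [Obj.mk_code, Equiv.symm_apply_apply]

theorem isSet_mkSet (S : Set (Obj A)) [Small.{u} S] : IsSet (mkSet S) := by
  intro a h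
  exact (Quotient.exact h : PreObj.Equiv _ _)

theorem ext_atom (a : A) : ext (atom a) = ∅ := rfl

theorem atom_injective : Function.Injective (atom : A → Obj A) := fun _ _ h =>
  (Quotient.exact h : PreObj.Equiv _ _)

theorem IsSet.eq_of_ext_eq {x y : Obj A} (hx : IsSet x) (hy : IsSet y) (h : ext x = ext y) :
    x = y := by
  induction x using Quotient.inductionOn with
  | h p =>
    induction y using Quotient.inductionOn with
    | h q =>
      cases p with
      | atom a => exact (hx a rfl).elim
      | fam ι f =>
        cases q with
        | atom b => exact (hy b rfl).elim
        | fam ι' g =>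
          refine Quotient.sound ⟨fun i => ?_, fun j => ?_⟩
          · have : (Quotient.mk _ (f i) : Obj A) ∈ ext (Quotient.mk _ (.fam ι' g)) := by
              rw [← h]; exact ⟨i, rfl⟩
            obtain ⟨j, hj⟩ := this
            exact ⟨j, (Quotient.exact hj).symm⟩
          · have : (Quotient.mk _ (g j) : Obj A) ∈ ext (Quotient.mk _ (.fam ι f)) := by
              rw [h]; exact ⟨j, rfl⟩
            obtain ⟨i, hi⟩ := this
            exact ⟨i, Quotient.exact hi⟩

/-- The singleton `{a}`. -/
noncomputable def single (a : Obj A) : Obj A := mkSet {a}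

/-- The Kuratowski ordered pair `(a, b) = {{a}, {a, b}}`. -/
noncomputable def opair (a b : Obj A) : Obj A := mkSet {single a, mkSet {a, b}}

/-- The union of two sets. -/
noncomputable def union (x y : Obj A) : Obj A := mkSet (ext x ∪ ext y)

/-- The intersection of two sets. -/
noncomputable def inter (x y : Obj A) : Obj A :=
  haveI : Small.{u} (ext x ∩ ext y : Set (Obj A)) := small_subset Set.inter_subset_left
  mkSet (ext x ∩ ext y)

/-- The Cartesian product of two sets. -/
noncomputable def cprod (x y : Obj A) : Obj A := mkSet (Set.image2 opair (ext x) (ext y))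

/-! ### The superstructure and the accessible universe -/

/-- The levels of the superstructure over a collection `X`:
`V_0(X) = X` and `V_{n+1}(X) = V_n(X) ∪ ℘(V_n(X))`. -/
def V (X : Set (Obj A)) : ℕ → Set (Obj A)
  | 0 => X
  | n + 1 => V X n ∪ {y | IsSet y ∧ ext y ⊆ V X n}

/-- The superstructure `V(𝔸)` over the atoms. -/
def VA (A : Type u) : Set (Obj A) := {x | ∃ n, x ∈ V (Set.range atom) n}

/-- `x` has fewer than `κ = #A` elements, and so do, hereditarily, all its elements. -/
inductive HereditarilySmall : Obj A → Prop
  | intro (x : Obj A) (hx : Cardinal.mk (ext x) < Cardinal.lift.{u + 1} (Cardinal.mk A))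
      (h : ∀ y ∈ ext x, HereditarilySmall y) : HereditarilySmall x

/-- The accessible universe `Λ`: objects of the superstructure over the atoms that are
hereditarily of cardinality less than `κ = #A`. -/
def Lam (A : Type u) : Set (Obj A) := {x | x ∈ VA A ∧ HereditarilySmall x}

/-- `Λ_S`, the sets in `Λ`. -/
def LamS (A : Type u) : Set (Obj A) := {x | x ∈ Lam A ∧ IsSet x}

/-- `𝔏`, the finite sets in `Λ`. -/
def FinL (A : Type u) : Set (Obj A) := {x | x ∈ LamS A ∧ (ext x).Finite}

theorem V_succ (X : Set (Obj A)) (n : ℕ) : V X n ⊆ V X (n + 1) := Set.subset_union_left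

theorem V_mono (X : Set (Obj A)) : Monotone (V X) := monotone_nat_of_le_succ (V_succ X)

theorem ext_subset_V {x : Obj A} {n : ℕ} (hx : x ∈ V (Set.range (atom : A → Obj A)) n) :
    ext x ⊆ V (Set.range atom) n := by
  induction n with
  | zero =>
    obtain ⟨a, rfl⟩ := hx
    rw [ext_atom]
    exact Set.empty_subset _
  | succ n ih =>
    rcases hx with hx | hx
    · exact (ih hx).trans (V_succ _ n)
    · exact hx.2.trans (V_succ _ n)

/-- A small bounded collection of elements of `Λ` forms an element of `Λ_S`. -/
theorem mkSet_mem_LamS {S : Set (Obj A)} [Small.{u} S] (n : ℕ)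
    (hV : S ⊆ V (Set.range atom) n) (hL : ∀ y ∈ S, HereditarilySmall y)
    (hS : Cardinal.mk S < Cardinal.lift.{u + 1} (Cardinal.mk A)) : mkSet S ∈ LamS A := by
  refine ⟨⟨⟨n + 1, Or.inr ⟨isSet_mkSet S, by rwa [ext_mkSet]⟩⟩, .intro _ ?_ ?_⟩, isSet_mkSet S⟩
  · rwa [ext_mkSet]
  · rwa [ext_mkSet]

theorem HereditarilySmall.card {x : Obj A} (h : HereditarilySmall x) :
    Cardinal.mk (ext x) < Cardinal.lift.{u + 1} (Cardinal.mk A) := by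
  cases h; assumption

theorem HereditarilySmall.elem {x : Obj A} (h : HereditarilySmall x) :
    ∀ y ∈ ext x, HereditarilySmall y := by
  cases h; assumption

theorem aleph0_lt_lift (hA : (Cardinal.mk A).IsInaccessible) :
    Cardinal.aleph0 < Cardinal.lift.{u + 1} (Cardinal.mk A) := by
  exact Cardinal.aleph0_lt_lift.2 hA.aleph0_lt

theorem finite_mem_LamS (hA : (Cardinal.mk A).IsInaccessible) {S : Set (Obj A)} [Small.{u} S]
    (hS : S.Finite) (n : ℕ) (hV : S ⊆ V (Set.range atom) n)
    (hL : ∀ y ∈ S, HereditarilySmall y) : mkSet S ∈ LamS A :=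
  mkSet_mem_LamS n hV hL ((Cardinal.lt_aleph0_iff_set_finite.2 hS).trans (aleph0_lt_lift hA))

theorem single_mem (hA : (Cardinal.mk A).IsInaccessible) {a : Obj A} (ha : a ∈ Lam A) :
    single a ∈ LamS A := by
  obtain ⟨⟨n, hn⟩, h⟩ := ha
  exact finite_mem_LamS hA (Set.finite_singleton a) n (by simpa using hn) (by simpa using h)

theorem opair_mem (hA : (Cardinal.mk A).IsInaccessible) {a b : Obj A} {n : ℕ}
    (hna : a ∈ V (Set.range atom) n) (hnb : b ∈ V (Set.range atom) n)
    (ha : HereditarilySmall a) (hb : HereditarilySmall b) :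
    opair a b ∈ V (Set.range atom) (n + 2) ∧ HereditarilySmall (opair a b) := by
  have h2 : mkSet {a, b} ∈ LamS A :=
    finite_mem_LamS hA (Set.toFinite _) n (by rintro y (rfl | rfl) <;> assumption)
      (by rintro y (rfl | rfl) <;> assumption)
  have h1 : single a ∈ LamS A := single_mem hA ⟨⟨n, hna⟩, ha⟩
  have v2 : mkSet {a, b} ∈ V (Set.range (atom : A → Obj A)) (n + 1) :=
    Or.inr ⟨isSet_mkSet _, by rw [ext_mkSet]; rintro y (rfl | rfl) <;> assumption⟩
  have v1 : single a ∈ V (Set.range (atom : A → Obj A)) (n + 1) :=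
    Or.inr ⟨isSet_mkSet _, by rw [single, ext_mkSet]; simpa using hna⟩
  refine ⟨Or.inr ⟨isSet_mkSet _, ?_⟩, ?_⟩
  · rw [opair, ext_mkSet]
    rintro y (rfl | rfl) <;> assumption
  · refine (finite_mem_LamS hA (Set.toFinite _) (n + 1) ?_ ?_).1.2
    · rintro y (rfl | rfl) <;> assumption
    · rintro y (rfl | rfl)
      exacts [h1.1.2, h2.1.2]

theorem union_mem (hA : (Cardinal.mk A).IsInaccessible) {x y : Obj A} (hx : x ∈ LamS A)
    (hy : y ∈ LamS A) : union x y ∈ LamS A := by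
  obtain ⟨⟨⟨n, hn⟩, h⟩, -⟩ := hx
  obtain ⟨⟨⟨m, hm⟩, h'⟩, -⟩ := hy
  refine mkSet_mem_LamS (max n m) ?_ ?_ ?_
  · exact Set.union_subset ((ext_subset_V hn).trans (V_mono _ (le_max_left n m)))
      ((ext_subset_V hm).trans (V_mono _ (le_max_right n m)))
  · rintro z (hz | hz)
    exacts [h.elem z hz, h'.elem z hz]
  · exact (Cardinal.mk_union_le _ _).trans_lt
      (Cardinal.add_lt_of_lt (aleph0_lt_lift hA).le h.card h'.card)

theorem cprod_mem (hA : (Cardinal.mk A).IsInaccessible) {x y : Obj A} (hx : x ∈ LamS A)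
    (hy : y ∈ LamS A) : cprod x y ∈ LamS A := by
  obtain ⟨⟨⟨n, hn⟩, h⟩, -⟩ := hx
  obtain ⟨⟨⟨m, hm⟩, h'⟩, -⟩ := hy
  have key : ∀ z ∈ Set.image2 opair (ext x) (ext y),
      z ∈ V (Set.range (atom : A → Obj A)) (max n m + 2) ∧ HereditarilySmall z := by
    rintro _ ⟨a, ha, b, hb, rfl⟩
    exact opair_mem hA (V_mono _ (le_max_left n m) (ext_subset_V hn ha))
      (V_mono _ (le_max_right n m) (ext_subset_V hm hb)) (h.elem a ha) (h'.elem b hb)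
  refine mkSet_mem_LamS (max n m + 2) (fun z hz => (key z hz).1) (fun z hz => (key z hz).2) ?_
  refine lt_of_le_of_lt ?_ (Cardinal.mul_lt_of_lt (aleph0_lt_lift hA).le h.card h'.card)
  rw [← Set.image_uncurry_prod]
  refine Cardinal.mk_image_le.trans (le_of_eq ?_)
  rw [Cardinal.mk_setProd]

theorem inter_mem (l : FinL A) (x : Obj A) : inter l.1 x ∈ FinL A := by
  obtain ⟨l, ⟨⟨⟨n, hn⟩, h⟩, -⟩, hf⟩ := l
  have : Small.{u} (ext l ∩ ext x : Set (Obj A)) := small_subset Set.inter_subset_left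
  refine ⟨mkSet_mem_LamS n (Set.inter_subset_left.trans (ext_subset_V hn))
    (fun y hy => h.elem y hy.1)
    ((Cardinal.mk_le_mk_of_subset Set.inter_subset_left).trans_lt h.card), ?_⟩
  rw [inter, ext_mkSet]
  exact hf.subset Set.inter_subset_left

/-- `λ ∩ x` as an element of `𝔏`. -/
noncomputable def FinL.inter (l : FinL A) (x : Obj A) : FinL A :=
  ⟨EuclideanUniverse.inter l.1 x, inter_mem l x⟩

theorem FinL.ext_inter (l : FinL A) (x : Obj A) : ext (FinL.inter l x).1 = ext l.1 ∩ ext x := by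
  have : Small.{u} (ext l.1 ∩ ext x : Set (Obj A)) := small_subset Set.inter_subset_left
  exact ext_mkSet _

theorem FinL.inter_inter (l : FinL A) {x y : Obj A} (h : ext y ⊆ ext x) :
    FinL.inter (FinL.inter l x) y = FinL.inter l y := by
  refine Subtype.ext (IsSet.eq_of_ext_eq (FinL.inter _ y).2.1.2 (FinL.inter _ y).2.1.2 ?_)
  rw [FinL.ext_inter, FinL.ext_inter, FinL.ext_inter, Set.inter_assoc, Set.inter_eq_right.2 h]

/-! ### The ultrafilter -/

/-- `Q(n₀, λ₀) = {V_n(λ) ∈ 𝔏 | n ≥ n₀, λ ∈ 𝔏, λ ⊇ λ₀}`. -/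
def Q (n₀ : ℕ) (l₀ : FinL A) : Set (FinL A) :=
  {m | ∃ n ≥ n₀, ∃ l : FinL A, ext l₀.1 ⊆ ext l.1 ∧ ext m.1 = V (ext l.1) n}

/-- The `λ ∈ 𝔏` that contain both components of every ordered pair they contain. -/
def pairClosed (A : Type u) : Set (FinL A) :=
  {l | ∀ a b : Obj A, opair a b ∈ ext l.1 → a ∈ ext l.1 ∧ b ∈ ext l.1}

/-- The ultrafilters over `𝔏` from which the model is built: they contain all `Q(n, λ)` and
the family of the pair-closed `λ`. -/
def Admissible (U : Ultrafilter (FinL A)) : Prop :=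
  (∀ (n : ℕ) (l : FinL A), Q n l ∈ U) ∧ pairClosed A ∈ U

/-! ### The iterated ultrapowers -/

/-- `𝔉(𝔏, K)`: the nets `φ : 𝔏 → K` with `φ(λ) = φ(λ ∩ B)` for some `B ∈ Λ_S` and all `λ`. -/
def Nets (hA : (Cardinal.mk A).IsInaccessible) (K : Type*) [CommRing K] :
    Subring (FinL A → K) where
  carrier := {φ | ∃ B ∈ LamS A, ∀ l, φ l = φ (FinL.inter l B)}
  zero_mem' := ⟨mkSet ∅, finite_mem_LamS hA Set.finite_empty 0 (Set.empty_subset _) (by simp),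
    fun _ => rfl⟩
  one_mem' := ⟨mkSet ∅, finite_mem_LamS hA Set.finite_empty 0 (Set.empty_subset _) (by simp),
    fun _ => rfl⟩
  neg_mem' := by
    rintro φ ⟨B, hB, h⟩
    exact ⟨B, hB, fun l => congrArg Neg.neg (h l)⟩
  add_mem' := by
    rintro φ ψ ⟨B, hB, h⟩ ⟨C, hC, h'⟩
    refine ⟨union B C, union_mem hA hB hC, fun l => ?_⟩
    have e : ext (union B C) = ext B ∪ ext C := ext_mkSet _
    change φ l + ψ l = φ _ + ψ _
    rw [h (FinL.inter l _), h' (FinL.inter l _), FinL.inter_inter l (e ▸ Set.subset_union_left),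
      FinL.inter_inter l (e ▸ Set.subset_union_right), ← h, ← h']
  mul_mem' := by
    rintro φ ψ ⟨B, hB, h⟩ ⟨C, hC, h'⟩
    refine ⟨union B C, union_mem hA hB hC, fun l => ?_⟩
    have e : ext (union B C) = ext B ∪ ext C := ext_mkSet _
    change φ l * ψ l = φ _ * ψ _
    rw [h (FinL.inter l _), h' (FinL.inter l _), FinL.inter_inter l (e ▸ Set.subset_union_left),
      FinL.inter_inter l (e ▸ Set.subset_union_right), ← h, ← h']

/-- The ideal of the nets that vanish on a member of `U`. -/
def nullIdeal (hA : (Cardinal.mk A).IsInaccessible) (U : Ultrafilter (FinL A)) (K : Type*)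
    [CommRing K] : Ideal (Nets hA K) where
  carrier := {φ | ∀ᶠ l in (U : Filter (FinL A)), φ.1 l = 0}
  zero_mem' := Filter.Eventually.of_forall fun _ => rfl
  add_mem' := by
    intro φ ψ h h'
    filter_upwards [h, h'] with l hl hl'
    change φ.1 l + ψ.1 l = 0
    rw [hl, hl', add_zero]
  smul_mem' := by
    intro c φ h
    filter_upwards [h] with l hl
    change c.1 l * φ.1 l = 0
    rw [hl, mul_zero]

/-- The constant net `C_x`. -/
def constNet (hA : (Cardinal.mk A).IsInaccessible) {K : Type*} [CommRing K] (x : K) :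
    Nets hA K :=
  ⟨fun _ => x, mkSet ∅, finite_mem_LamS hA Set.finite_empty 0 (Set.empty_subset _) (by simp),
    fun _ => rfl⟩

/-- The ultrapower `𝔉(𝔏, K) / I`. -/
abbrev Ultrapower (hA : (Cardinal.mk A).IsInaccessible) (U : Ultrafilter (FinL A)) (K : Type*)
    [CommRing K] : Type _ := Nets hA K ⧸ nullIdeal hA U K

/-- A tower `K_j`, `j ≤ κ`, of iterated ultrapowers inside the set `A` of atoms, `κ = #A`,
over a copy `r : ℝ ↪ A` of the real numbers. The field `K_κ` is `E`, and the `K_j` are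
ordered subfields of it. -/
structure Tower (hA : (Cardinal.mk A).IsInaccessible) (r : ℝ ↪ A)
    (U : Ultrafilter (FinL A)) where
  /-- the set of atoms that are elements of `K_κ` -/
  E : Set A
  /-- the field structure of `K_κ` -/
  [field : Field E]
  /-- the order of `K_κ` -/
  [order : LinearOrder E]
  [ordered : IsStrictOrderedRing E]
  /-- the ordered fields `K_j` -/
  K : Ordinal.{u} → Subfield E
  mono : ∀ i j, i ≤ j → j ≤ (Cardinal.mk A).ord → K i ≤ K j
  /-- the real numbers, as elements of `K_κ` -/
  real : ℝ →+*o E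
  real_eq : ∀ x, (real x : A) = r x
  zero_eq : (K 0 : Set E) = Set.range real
  /-- the injection `Θ_j` of the ultrapower of `K_j` into the atoms. It is a ring homomorphism
  and preserves the order: `K_{j+1}` carries the structure transported along `Θ_j`. -/
  Θ : ∀ j, j < (Cardinal.mk A).ord → Ultrapower hA U (K j) →+* E
  Θ_injective : ∀ j hj, Function.Injective (Θ j hj)
  Θ_range : ∀ j hj, Set.range (Θ j hj) = K (j + 1)
  Θ_le_iff : ∀ j hj (φ ψ : Nets hA (K j)),
    Θ j hj (Ideal.Quotient.mk _ φ) ≤ Θ j hj (Ideal.Quotient.mk _ ψ) ↔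
      ∀ᶠ l in (U : Filter (FinL A)), φ.1 l ≤ ψ.1 l
  /-- constant real nets are sent to their values -/
  Θ_const : ∀ (h0 : 0 < (Cardinal.mk A).ord) (x : K 0),
    Θ 0 h0 (Ideal.Quotient.mk _ (constNet hA x)) = x
  /-- coherence: `J_j = Θ_j ∘ Π_j` extends `J_i` for `i ≤ j` -/
  Θ_coherent : ∀ i j (hi : i < (Cardinal.mk A).ord) (hj : j < (Cardinal.mk A).ord), i ≤ j →
    ∀ (φ : Nets hA (K i)) (ψ : Nets hA (K j)), (∀ l, (φ.1 l : E) = ψ.1 l) →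
      Θ i hi (Ideal.Quotient.mk _ φ) = Θ j hj (Ideal.Quotient.mk _ ψ)
  limit_eq : ∀ k, Order.IsSuccLimit k → k ≤ (Cardinal.mk A).ord →
    (K k : Set E) = ⋃ j < k, (K j : Set E)
  top_eq : K (Cardinal.mk A).ord = ⊤
  /-- the direct limit `J = J_κ` of the maps `J_j` -/
  J : Nets hA E → E
  J_eq : ∀ j (hj : j < (Cardinal.mk A).ord) (φ : Nets hA (K j)) (ψ : Nets hA E),
    (∀ l, (φ.1 l : E) = ψ.1 l) → J ψ = Θ j hj (Ideal.Quotient.mk _ φ)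

attribute [instance] Tower.field Tower.order Tower.ordered

/-- The net `λ ↦ |λ ∩ X|`. -/
noncomputable def cardNet (hA : (Cardinal.mk A).IsInaccessible) (K : Type*) [CommRing K]
    (X : LamS A) : Nets hA K :=
  ⟨fun l => ((ext (FinL.inter l X.1).1).ncard : K), X.1, X.2, fun l => by
    change ((ext (FinL.inter l X.1).1).ncard : K) =
      ((ext (FinL.inter (FinL.inter l X.1) X.1).1).ncard : K)
    rw [FinL.inter_inter l subset_rfl]⟩

variable {hA : (Cardinal.mk A).IsInaccessible} {r : ℝ ↪ A} {U : Ultrafilter (FinL A)}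

/-- The numerosity `num(X) = J(|λ ∩ X|)`, an element of `K_κ`. -/
noncomputable def Tower.num (M : Tower hA r U) (X : LamS A) : M.E := M.J (cardNet hA M.E X)

/-- The set `𝔑` of the numerosities, a set of atoms. -/
def Tower.numerosities (M : Tower hA r U) : Set A := Set.range fun X => (M.num X : A)

/-- Numerosities are elements of `K_κ`. -/
def Tower.toE (M : Tower hA r U) (ν : M.numerosities) : M.E :=
  ⟨ν.1, by obtain ⟨X, hX⟩ := ν.2; exact hX ▸ (M.num X).2⟩

theorem Tower.toE_injective (M : Tower hA r U) : Function.Injective M.toE := fun _ _ h =>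
  Subtype.ext (congrArg (fun z : M.E => (z : A)) h)

/-- `𝔑` is ordered as a subset of `K_κ`. -/
noncomputable instance Tower.numOrder (M : Tower hA r U) : LinearOrder M.numerosities :=
  LinearOrder.lift' M.toE M.toE_injective

/-- The numerosity function, as a map onto `𝔑`. -/
noncomputable def Tower.numMap (M : Tower hA r U) (X : LamS A) : M.numerosities :=
  ⟨M.num X, X, rfl⟩

/-! ### The numerosity axiom -/

/-- `{a}` as an element of `Λ_S`. -/
noncomputable def LamS.single (hA : (Cardinal.mk A).IsInaccessible) (a : Lam A) : LamS A :=
  ⟨EuclideanUniverse.single a.1, single_mem hA a.2⟩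

/-- `X ∪ Y` as an element of `Λ_S`. -/
noncomputable def LamS.union (hA : (Cardinal.mk A).IsInaccessible) (X Y : LamS A) : LamS A :=
  ⟨EuclideanUniverse.union X.1 Y.1, union_mem hA X.2 Y.2⟩

/-- `X × Y` as an element of `Λ_S`. -/
noncomputable def LamS.prod (hA : (Cardinal.mk A).IsInaccessible) (X Y : LamS A) : LamS A :=
  ⟨cprod X.1 Y.1, cprod_mem hA X.2 Y.2⟩

/-- The numerosity axiom for a map `num : Λ_S → 𝔑` onto an ordered set `𝔑` of atoms. -/
structure NumerosityAxiom (hA : (Cardinal.mk A).IsInaccessible) {N : Set A} [LinearOrder N]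
    (num : LamS A → N) : Prop where
  surjective : Function.Surjective num
  singleton : ∀ a b : Lam A, num (LamS.single hA a) = num (LamS.single hA b)
  lt_of_ssubset : ∀ X Y : LamS A, ext X.1 ⊂ ext Y.1 → num X < num Y
  union : ∀ X Y X' Y' : LamS A, Disjoint (ext X.1) (ext Y.1) → Disjoint (ext X'.1) (ext Y'.1) →
    num X = num X' → num Y = num Y' → num (LamS.union hA X Y) = num (LamS.union hA X' Y')
  prod : ∀ X Y X' Y' : LamS A, num X = num X' → num Y = num Y' →
    num (LamS.prod hA X Y) = num (LamS.prod hA X' Y')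
  prod_singleton : ∀ (X : LamS A) (b : Lam A), num (LamS.prod hA X (LamS.single hA b)) = num X

end EuclideanUniverse

/-!
The numerosity `num(X)` is the value `J(|λ ∩ X|)` of a counting net. Counting nets take natural
numbers as values, so only the first ultrapower matters for the axioms: there `J_0` is a ring
homomorphism, and it identifies and compares nets according to their values at almost all `λ`. The
additivity and the strict monotonicity of `num` are then those of finite cardinalities, because
almost every `λ` contains a given element of `Λ`. The product formula holds because almost every
`λ` contains a pair from `X × Y` exactly if it contains the two components
(`eventually_opair_mem_iff`): one direction is pair-closedness, and for the other one, `λ =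
V_n(μ)` with `n` at least the rank `m` of the elements of `X` and `Y` plus two; elements of
`V_n(μ)` of rank at most `m` already lie in `V_m(μ)` (`mem_V_of_rank_le`), so that their pairs lie
in `V_{m+2}(μ)`.

*Admissible ultrafilters.* The sets `Q(n, λ)` are directed, so it suffices that each of them
contains a pair-closed element (`Q_inter_pairClosed_nonempty`). A finite `λ` is enlarged to a
finite set that contains the elements of its finite members; such a closure is finite because
membership is well-founded. This closedness passes to `V_n` and implies pair-closedness.

*Towers.* A direct limit of length `κ` is avoided by constructing at once an ordered field
`NetLimit` that contains the real numbers and is isomorphic to its own full ultrapower: its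
elements are the well-founded trees of nets with real leaves (nets, nets of nets, and so on),
modulo hereditary almost everywhere equality. Operations and order are computed at the leaves, and
the axioms of ordered fields transfer by induction on trees. Forming the limit of a net is an
order-reflecting ring homomorphism `limHom` that fixes the constant real nets. Inside this field
the tower is a transfinite increasing sequence of subfields: `K_{j+1}` consists of the limits of
the nets in `𝔉(𝔏, K_j)`, and unions are taken at limits (`stage`). Coherence is automatic since
all `Θ_j` are restrictions of one map. Since `κ` is inaccessible, there are at most `κ` nets over
a field with at most `κ` elements (`mk_Nets_le`), so `K_κ` has at most `κ` elements. As there are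
`κ` atoms that are not real numbers, `K_κ` embeds into the atoms over the given copy of `ℝ`
(`exists_embedding`), and its structure is transported along this embedding (`nonempty_tower`).
-/

namespace EuclideanUniverse

variable {A : Type u}

/-! ### Well-founded trees of nets -/

section NetTree

universe v w

/-- Well-founded trees of nets: the elements of `k`, the nets `I → k`, the nets of nets, and so
on transfinitely. -/
inductive NetTree (I : Type v) (k : Type w) : Type (max v w)
  | leaf (x : k) : NetTree I k
  | node (φ : I → NetTree I k) : NetTree I k

namespace NetTree

variable {I : Type v} {k : Type w}

/-- The value of a tree at an index, where an element of `k` is read as a constant net. -/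
def coord : NetTree I k → I → NetTree I k
  | leaf x, _ => leaf x
  | node φ, i => φ i

/-- Apply a unary operation at the leaves. -/
def map (f : k → k) : NetTree I k → NetTree I k
  | leaf x => leaf (f x)
  | node φ => node fun i => map f (φ i)

/-- Apply a binary operation at the leaves, leaves being read as constant nets where necessary. -/
def map₂ (f : k → k → k) : NetTree I k → NetTree I k → NetTree I k
  | leaf x => map (f x)
  | node φ => fun t => node fun i => map₂ f (φ i) (t.coord i)

theorem map_coord (f : k → k) (s : NetTree I k) (i : I) :
    (map f s).coord i = map f (s.coord i) := by
  cases s <;> rfl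

theorem map₂_coord (f : k → k → k) (s t : NetTree I k) (i : I) :
    (map₂ f s t).coord i = map₂ f (s.coord i) (t.coord i) := by
  cases s
  · exact map_coord _ _ _
  · rfl

/-- Simultaneous induction on three trees: a property that holds for leaves, and for trees as
soon as it holds for all their values, holds always. -/
theorem induction₃ {P : NetTree I k → NetTree I k → NetTree I k → Prop}
    (hleaf : ∀ x y z, P (leaf x) (leaf y) (leaf z))
    (hat : ∀ a b c, (∀ i, P (a.coord i) (b.coord i) (c.coord i)) → P a b c) (a b c : NetTree I k) :
    P a b c := by
  induction a generalizing b c with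
  | node φ ih => exact hat _ _ _ fun i => ih i _ _
  | leaf x =>
    induction b generalizing c with
    | node φ ih => exact hat _ _ _ fun i => ih i _
    | leaf y =>
      induction c with
      | node φ ih => exact hat _ _ _ fun i => ih i
      | leaf z => exact hleaf x y z

/-- Simultaneous induction on two trees. -/
theorem induction₂ {P : NetTree I k → NetTree I k → Prop}
    (hleaf : ∀ x y, P (leaf x) (leaf y))
    (hat : ∀ a b, (∀ i, P (a.coord i) (b.coord i)) → P a b) (a b : NetTree I k) : P a b :=
  induction₃ (P := fun a b _ => P a b) (fun x y _ => hleaf x y) (fun a b _ => hat a b) a b a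

variable (U : Ultrafilter I)

/-- The lift of a predicate on `k` to trees: it holds of a net if it holds at almost all
indices. -/
def LiftPred (p : k → Prop) : NetTree I k → Prop
  | leaf x => p x
  | node φ => ∀ᶠ i in (U : Filter I), LiftPred p (φ i)

/-- The lift of a binary relation on `k` to trees. -/
def LiftRel (p : k → k → Prop) : NetTree I k → NetTree I k → Prop
  | leaf x => LiftPred U (p x)
  | node φ => fun t => ∀ᶠ i in (U : Filter I), LiftRel p (φ i) (t.coord i)

variable {U}

/-- The relation between two trees is decided by their values at almost all indices. -/
theorem liftRel_iff {p : k → k → Prop} {s t : NetTree I k} :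
    LiftRel U p s t ↔ ∀ᶠ i in (U : Filter I), LiftRel U p (s.coord i) (t.coord i) := by
  cases s with
  | node φ => rfl
  | leaf x =>
    cases t with
    | node ψ => rfl
    | leaf y => exact Filter.eventually_const.symm

theorem liftRel_and {p q : k → k → Prop} : ∀ a b : NetTree I k,
    LiftRel U (fun x y => p x y ∧ q x y) a b ↔ LiftRel U p a b ∧ LiftRel U q a b := by
  refine induction₂ (fun _ _ => Iff.rfl) fun a b h => ?_
  rw [liftRel_iff, liftRel_iff (p := p), liftRel_iff (p := q), ← Filter.eventually_and]
  exact Filter.eventually_congr (.of_forall h)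

theorem liftRel_refl {p : k → k → Prop} (h : ∀ x, p x x) (a : NetTree I k) : LiftRel U p a a := by
  induction a with
  | leaf x => exact h x
  | node φ ih => exact Filter.Eventually.of_forall ih

theorem liftRel_swap {p : k → k → Prop} : ∀ a b : NetTree I k,
    LiftRel U (fun x y => p y x) a b ↔ LiftRel U p b a := by
  refine induction₂ (fun _ _ => Iff.rfl) fun a b h => ?_
  rw [liftRel_iff, liftRel_iff (p := p)]
  exact Filter.eventually_congr (.of_forall h)

theorem liftRel_trans {p : k → k → Prop} (h : ∀ x y z, p x y → p y z → p x z) :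
    ∀ a b c : NetTree I k, LiftRel U p a b → LiftRel U p b c → LiftRel U p a c := by
  refine induction₃ h fun a b c h => ?_
  rw [liftRel_iff, liftRel_iff (s := b), liftRel_iff (s := a) (t := c)]
  intro h1 h2
  filter_upwards [h1, h2] with i h1 h2 using h i h1 h2

theorem liftRel_total {p : k → k → Prop} (h : ∀ x y, p x y ∨ p y x) :
    ∀ a b : NetTree I k, LiftRel U p a b ∨ LiftRel U p b a := by
  refine induction₂ h fun a b h => ?_
  rw [liftRel_iff, liftRel_iff (s := b), ← Ultrafilter.eventually_or]
  exact Filter.Eventually.of_forall h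

theorem eqv_map₂_left (f : k → k → k) : ∀ a b c : NetTree I k,
    LiftRel U (· = ·) a b → LiftRel U (· = ·) (map₂ f a c) (map₂ f b c) := by
  refine induction₃ (fun x y z h => ?_) fun a b c h => ?_
  · cases (show x = y from h)
    exact liftRel_refl (fun _ => rfl) _
  · rw [liftRel_iff, liftRel_iff (s := map₂ f a c)]
    intro h1
    filter_upwards [h1] with i h1
    rw [map₂_coord, map₂_coord]
    exact h i h1

theorem eqv_map₂_right (f : k → k → k) : ∀ a b c : NetTree I k,
    LiftRel U (· = ·) a b → LiftRel U (· = ·) (map₂ f c a) (map₂ f c b) := by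
  refine induction₃ (fun x y z h => ?_) fun a b c h => ?_
  · cases (show x = y from h)
    exact liftRel_refl (fun _ => rfl) _
  · rw [liftRel_iff, liftRel_iff (s := map₂ f c a)]
    intro h1
    filter_upwards [h1] with i h1
    rw [map₂_coord, map₂_coord]
    exact h i h1

theorem eqv_map (f : k → k) : ∀ a b : NetTree I k,
    LiftRel U (· = ·) a b → LiftRel U (· = ·) (map f a) (map f b) := by
  refine induction₂ (fun x y h => ?_) fun a b h => ?_
  · cases (show x = y from h)
    exact liftRel_refl (fun _ => rfl) _
  · rw [liftRel_iff, liftRel_iff (s := map f a)]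
    intro h1
    filter_upwards [h1] with i h1
    rw [map_coord, map_coord]
    exact h i h1

end NetTree

variable {I : Type v} {k : Type w}

/-- Trees that agree almost everywhere, hereditarily. -/
def NetTree.setoid (U : Ultrafilter I) (k : Type w) : Setoid (NetTree I k) where
  r := NetTree.LiftRel U (· = ·)
  iseqv :=
    { refl := NetTree.liftRel_refl fun _ => rfl
      symm := fun {a b} h => by
        rw [← NetTree.liftRel_swap]
        simpa only [eq_comm] using h
      trans := fun {a b c} =>
        NetTree.liftRel_trans (p := (· = ·)) (fun _ _ _ => Eq.trans) a b c }

/-- The trees of nets modulo almost everywhere equality: an extension of `k` that is isomorphic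
to its own ultrapower. -/
def NetLimit (U : Ultrafilter I) (k : Type w) : Type (max v w) := Quotient (NetTree.setoid U k)

namespace NetLimit

open NetTree

variable {U : Ultrafilter I}

theorem mk_eq_iff {a b : NetTree I k} :
    (Quotient.mk (NetTree.setoid U k) a = Quotient.mk (NetTree.setoid U k) b) ↔
      LiftRel U (· = ·) a b := Quotient.eq

/-- An operation of `k`, on the limit. -/
def op₂ (f : k → k → k) : NetLimit U k → NetLimit U k → NetLimit U k :=
  Quotient.map₂ (map₂ f) fun a a' ha b b' hb =>
    (NetTree.setoid U k).trans (eqv_map₂_right f b b' a hb) (eqv_map₂_left f a a' b' ha)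

/-- A unary operation of `k`, on the limit. -/
def op₁ (f : k → k) : NetLimit U k → NetLimit U k :=
  Quotient.map (map f) fun a b => eqv_map f a b

/-- The elements of `k`, in the limit. -/
def const (x : k) : NetLimit U k := Quotient.mk _ (leaf x)

/-- The limit of a net. -/
noncomputable def lim (φ : I → NetLimit U k) : NetLimit U k :=
  Quotient.mk _ (node fun i => (φ i).out)

theorem const_inj {x y : k} : (const x : NetLimit U k) = const y ↔ x = y := mk_eq_iff

theorem lim_mk (φ : I → NetTree I k) :
    lim (fun i => Quotient.mk (NetTree.setoid U k) (φ i)) = Quotient.mk _ (node φ) :=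
  mk_eq_iff.2 (.of_forall fun i => Quotient.mk_out (s := NetTree.setoid U k) (φ i))

/-- Every element of the limit is the limit of a net. -/
theorem mk_eq_lim (a : NetTree I k) :
    (Quotient.mk _ a : NetLimit U k) = lim fun i => Quotient.mk _ (a.coord i) := by
  rw [lim_mk]
  exact mk_eq_iff.2 (liftRel_iff.2 (.of_forall fun i => liftRel_refl (fun _ => rfl) _))

theorem mk_out_eq (a : NetLimit U k) : Quotient.mk _ (Quotient.out a) = a := Quotient.out_eq a

/-- Almost everywhere equality decides the equality of limits. -/
theorem lim_eq_iff {φ ψ : I → NetLimit U k} :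
    lim φ = lim ψ ↔ ∀ᶠ i in (U : Filter I), φ i = ψ i := by
  refine mk_eq_iff.trans (Filter.eventually_congr (.of_forall fun i => ?_))
  conv_rhs => rw [← mk_out_eq (φ i), ← mk_out_eq (ψ i)]
  exact mk_eq_iff.symm

theorem lim_const (x : k) : lim (fun _ => const x) = (const x : NetLimit U k) :=
  (mk_eq_lim (leaf x)).symm

theorem op₂_lim (f : k → k → k) (φ ψ : I → NetLimit U k) :
    op₂ f (lim φ) (lim ψ) = lim fun i => op₂ f (φ i) (ψ i) := by
  rw [lim, lim]
  refine (lim_mk fun i => map₂ f (φ i).out (ψ i).out).symm.trans (congrArg lim ?_)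
  funext i
  conv_rhs => rw [← (φ i).out_eq, ← (ψ i).out_eq]
  rfl

theorem op₁_lim (f : k → k) (φ : I → NetLimit U k) :
    op₁ f (lim φ) = lim fun i => op₁ f (φ i) := by
  rw [lim]
  refine (lim_mk fun i => map f (φ i).out).symm.trans (congrArg lim ?_)
  funext i
  conv_rhs => rw [← (φ i).out_eq]
  rfl

/-- Simultaneous induction: what holds for elements of `k`, and is inherited by limits of nets,
holds for all elements of the limit. This is the form in which the first-order properties of `k`
are transferred. -/
theorem induction₃ {P : NetLimit U k → NetLimit U k → NetLimit U k → Prop}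
    (hconst : ∀ x y z, P (const x) (const y) (const z))
    (hlim : ∀ φ ψ χ : I → NetLimit U k, (∀ i, P (φ i) (ψ i) (χ i)) → P (lim φ) (lim ψ) (lim χ))
    (a b c : NetLimit U k) : P a b c := by
  induction a using Quotient.inductionOn with | h a
  induction b using Quotient.inductionOn with | h b
  induction c using Quotient.inductionOn with | h c
  refine NetTree.induction₃ (P := fun a b c => P (Quotient.mk _ a) (Quotient.mk _ b)
    (Quotient.mk _ c)) hconst (fun a b c h => ?_) a b c
  rw [mk_eq_lim a, mk_eq_lim b, mk_eq_lim c]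
  exact hlim _ _ _ h

/-- Simultaneous induction on two elements of the limit. -/
theorem induction₂ {P : NetLimit U k → NetLimit U k → Prop} (hconst : ∀ x y, P (const x) (const y))
    (hlim : ∀ φ ψ : I → NetLimit U k, (∀ i, P (φ i) (ψ i)) → P (lim φ) (lim ψ))
    (a b : NetLimit U k) : P a b :=
  induction₃ (P := fun a b _ => P a b) (fun x y _ => hconst x y) (fun φ ψ _ => hlim φ ψ) a b a

/-- Induction on an element of the limit. -/
theorem induction₁ {P : NetLimit U k → Prop} (hconst : ∀ x, P (const x))
    (hlim : ∀ φ : I → NetLimit U k, (∀ i, P (φ i)) → P (lim φ)) (a : NetLimit U k) : P a :=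
  induction₂ (P := fun a _ => P a) (fun x _ => hconst x) (fun φ _ => hlim φ) a a

section Field

variable [Field k]

instance : Add (NetLimit U k) := ⟨op₂ (· + ·)⟩
instance : Mul (NetLimit U k) := ⟨op₂ (· * ·)⟩
instance : Neg (NetLimit U k) := ⟨op₁ (- ·)⟩
instance : Inv (NetLimit U k) := ⟨op₁ (·⁻¹)⟩
instance : Zero (NetLimit U k) := ⟨const 0⟩
instance : One (NetLimit U k) := ⟨const 1⟩

/-- The operations of a field `k`, computed at the leaves. -/
noncomputable instance : Field (NetLimit U k) where
  nsmul := nsmulRec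
  zsmul := zsmulRec
  qsmul := _
  nnqsmul := _
  add_assoc := by
    change ∀ a b c, op₂ _ (op₂ _ a b) c = op₂ _ a (op₂ _ b c)
    refine induction₃ (fun x y z => const_inj.2 (add_assoc x y z)) fun φ ψ χ h => ?_
    simp only [op₂_lim, h]
  zero_add := by
    change ∀ a, op₂ _ (const 0) a = a
    refine induction₁ (fun x => const_inj.2 (zero_add x)) fun φ h => ?_
    rw [← lim_const, op₂_lim]
    simp only [h]
  add_zero := by
    change ∀ a, op₂ _ a (const 0) = a
    refine induction₁ (fun x => const_inj.2 (add_zero x)) fun φ h => ?_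
    rw [← lim_const, op₂_lim]
    simp only [h]
  add_comm := by
    change ∀ a b, op₂ _ a b = op₂ _ b a
    refine induction₂ (fun x y => const_inj.2 (add_comm x y)) fun φ ψ h => ?_
    simp only [op₂_lim, h]
  left_distrib := by
    change ∀ a b c, op₂ _ a (op₂ _ b c) = op₂ _ (op₂ _ a b) (op₂ _ a c)
    refine induction₃ (fun x y z => const_inj.2 (mul_add x y z)) fun φ ψ χ h => ?_
    simp only [op₂_lim, h]
  right_distrib := by
    change ∀ a b c, op₂ _ (op₂ _ a b) c = op₂ _ (op₂ _ a c) (op₂ _ b c)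
    refine induction₃ (fun x y z => const_inj.2 (add_mul x y z)) fun φ ψ χ h => ?_
    simp only [op₂_lim, h]
  zero_mul := by
    change ∀ a, op₂ _ (const 0) a = const 0
    refine induction₁ (fun x => const_inj.2 (zero_mul x)) fun φ h => ?_
    rw [← lim_const, op₂_lim]
    simp only [h]
  mul_zero := by
    change ∀ a, op₂ _ a (const 0) = const 0
    refine induction₁ (fun x => const_inj.2 (mul_zero x)) fun φ h => ?_
    rw [← lim_const, op₂_lim]
    simp only [h]
  mul_assoc := by
    change ∀ a b c, op₂ _ (op₂ _ a b) c = op₂ _ a (op₂ _ b c)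
    refine induction₃ (fun x y z => const_inj.2 (mul_assoc x y z)) fun φ ψ χ h => ?_
    simp only [op₂_lim, h]
  one_mul := by
    change ∀ a, op₂ _ (const 1) a = a
    refine induction₁ (fun x => const_inj.2 (one_mul x)) fun φ h => ?_
    rw [← lim_const, op₂_lim]
    simp only [h]
  mul_one := by
    change ∀ a, op₂ _ a (const 1) = a
    refine induction₁ (fun x => const_inj.2 (mul_one x)) fun φ h => ?_
    rw [← lim_const, op₂_lim]
    simp only [h]
  mul_comm := by
    change ∀ a b, op₂ _ a b = op₂ _ b a
    refine induction₂ (fun x y => const_inj.2 (mul_comm x y)) fun φ ψ h => ?_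
    simp only [op₂_lim, h]
  neg_add_cancel := by
    change ∀ a, op₂ _ (op₁ _ a) a = const 0
    refine induction₁ (fun x => const_inj.2 (neg_add_cancel x)) fun φ h => ?_
    simp only [op₂_lim, op₁_lim, h, lim_const]
  exists_pair_ne := ⟨const 0, const 1, fun h => zero_ne_one (const_inj.1 h)⟩
  mul_inv_cancel := by
    change ∀ a, a ≠ const 0 → op₂ _ a (op₁ _ a) = const 1
    refine induction₁
      (fun x h => const_inj.2 (mul_inv_cancel₀ fun h' => h (congrArg const h'))) fun φ h h0 => ?_
    rw [op₁_lim, op₂_lim, ← lim_const, lim_eq_iff]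
    rw [← lim_const, Ne, lim_eq_iff, ← Ultrafilter.eventually_not] at h0
    filter_upwards [h0] with i hi using h i hi
  inv_zero := const_inj.2 inv_zero

/-- The limit of nets, as a ring homomorphism. -/
noncomputable def limHom (U : Ultrafilter I) (k : Type w) [Field k] :
    (I → NetLimit U k) →+* NetLimit U k where
  toFun := lim
  map_one' := lim_const 1
  map_zero' := lim_const 0
  map_add' φ ψ := (op₂_lim _ φ ψ).symm
  map_mul' φ ψ := (op₂_lim _ φ ψ).symm

/-- The inclusion of `k`, as a ring homomorphism. -/
def constHom (U : Ultrafilter I) (k : Type w) [Field k] : k →+* NetLimit U k where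
  toFun := const
  map_one' := rfl
  map_zero' := rfl
  map_add' _ _ := rfl
  map_mul' _ _ := rfl

theorem limHom_eq_zero {φ : I → NetLimit U k} :
    limHom U k φ = 0 ↔ ∀ᶠ i in (U : Filter I), φ i = 0 := by
  change lim φ = const 0 ↔ _
  rw [← lim_const, lim_eq_iff]
  rfl

theorem limHom_inv (φ : I → NetLimit U k) : limHom U k (φ⁻¹) = (limHom U k φ)⁻¹ :=
  (op₁_lim _ φ).symm

theorem limHom_const (x : k) :
    limHom U k (fun _ => constHom U k x) = constHom U k x := lim_const x

end Field

section Order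

variable [LinearOrder k]

/-- Trees are compared at their leaves. The order is total because `U` is an ultrafilter. -/
noncomputable instance : LinearOrder (NetLimit U k) where
  le := Quotient.lift₂ (LiftRel U (· ≤ ·)) (by
    have key : ∀ a a' b b' : NetTree I k, LiftRel U (· = ·) a a' → LiftRel U (· = ·) b b' →
        LiftRel U (· ≤ ·) a b → LiftRel U (· ≤ ·) a' b' := by
      intro a a' b b' ha hb h
      have hle : ∀ {c d : NetTree I k}, LiftRel U (· = ·) c d →
          LiftRel U (· ≤ ·) c d ∧ LiftRel U (fun x y => y ≤ x) c d := by
        intro c d hcd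
        rw [← liftRel_and]
        simpa only [le_antisymm_iff] using hcd
      have t := NetTree.liftRel_trans (U := U) (I := I) (p := ((· ≤ ·) : k → k → Prop))
        fun _ _ _ => le_trans
      exact t _ _ _ ((liftRel_swap a a').1 (hle ha).2) (t _ _ _ h (hle hb).1)
    intro a b a' b' ha hb
    exact propext ⟨key _ _ _ _ ha hb,
      key _ _ _ _ ((NetTree.setoid U k).symm ha) ((NetTree.setoid U k).symm hb)⟩)
  le_refl a := by
    induction a using Quotient.inductionOn with | h a
    exact liftRel_refl (p := (· ≤ ·)) le_refl a
  le_trans a b c := by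
    induction a using Quotient.inductionOn with | h a
    induction b using Quotient.inductionOn with | h b
    induction c using Quotient.inductionOn with | h c
    exact liftRel_trans (p := (· ≤ ·)) (fun _ _ _ => le_trans) a b c
  le_antisymm a b := by
    induction a using Quotient.inductionOn with | h a
    induction b using Quotient.inductionOn with | h b
    intro h h'
    refine mk_eq_iff.2 ?_
    simp only [le_antisymm_iff]
    exact (liftRel_and a b).2 ⟨h, (liftRel_swap a b).2 h'⟩
  le_total a b := by
    induction a using Quotient.inductionOn with | h a
    induction b using Quotient.inductionOn with | h b
    exact liftRel_total (p := (· ≤ ·)) le_total a b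
  toDecidableLE := Classical.decRel _

/-- Comparison almost everywhere decides the comparison of limits. -/
theorem lim_le_iff {φ ψ : I → NetLimit U k} :
    lim φ ≤ lim ψ ↔ ∀ᶠ i in (U : Filter I), φ i ≤ ψ i := by
  refine Filter.eventually_congr (.of_forall fun i => ?_)
  conv_rhs => rw [← (φ i).out_eq, ← (ψ i).out_eq]
  rfl

theorem const_le {x y : k} : (const x : NetLimit U k) ≤ const y ↔ x ≤ y := Iff.rfl

end Order

section OrderedField

variable [Field k] [LinearOrder k]

theorem limHom_le_iff {φ ψ : I → NetLimit U k} :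
    limHom U k φ ≤ limHom U k ψ ↔ ∀ᶠ i in (U : Filter I), φ i ≤ ψ i := lim_le_iff

theorem constHom_le {x y : k} : constHom U k x ≤ constHom U k y ↔ x ≤ y := Iff.rfl

variable [IsStrictOrderedRing k]

instance : IsOrderedAddMonoid (NetLimit U k) where
  add_le_add_left a b hab c := by
    revert a b c
    suffices ∀ a b c : NetLimit U k, a ≤ b → a + c ≤ b + c from fun a b h c => this a b c h
    refine induction₃ (fun x y z h => ?_) fun φ ψ χ h h1 => ?_
    · exact (add_le_add_left (const_le.1 h) z : x + z ≤ y + z)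
    change limHom U k φ + limHom U k χ ≤ limHom U k ψ + limHom U k χ
    rw [← map_add, ← map_add, limHom_le_iff]
    filter_upwards [lim_le_iff.1 h1] with i hi using h i hi

instance : ZeroLEOneClass (NetLimit U k) := ⟨(zero_le_one : (0 : k) ≤ 1)⟩

instance : IsStrictOrderedRing (NetLimit U k) :=
  IsStrictOrderedRing.of_mul_pos (fun a b ha hb => by
    have key : 0 ≤ a → 0 ≤ b → 0 ≤ a * b := by
      clear ha hb
      revert a b
      refine induction₂ (fun x y hx hy => ?_) fun φ ψ h h1 h2 => ?_
      · exact (mul_nonneg hx hy : (0 : k) ≤ x * y)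
      change 0 ≤ limHom U k φ at h1
      change 0 ≤ limHom U k ψ at h2
      change 0 ≤ limHom U k φ * limHom U k ψ
      rw [← map_zero (limHom U k), limHom_le_iff] at h1 h2
      rw [← map_mul, ← map_zero (limHom U k), limHom_le_iff]
      filter_upwards [h1, h2] with i h1 h2 using h i h1 h2
    exact lt_of_le_of_ne (key ha.le hb.le) (mul_ne_zero ha.ne' hb.ne').symm)

end OrderedField

end NetLimit

end NetTree

/-! ### The iterated ultrapowers inside the field of trees -/

section Stages

variable (hA : (Cardinal.mk A).IsInaccessible) {U : Ultrafilter (FinL A)}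

open NetLimit

/-- The limit of the nets of `𝔉(𝔏, F)`, for a field `F` mapped to the field of trees. -/
noncomputable def netHom {F : Type*} [Field F] (g : F →+* NetLimit U ℝ) :
    Nets hA F →+* NetLimit U ℝ :=
  (limHom U ℝ).comp ((g.compLeft (FinL A)).comp (Nets hA F).subtype)

theorem netHom_apply {F : Type*} [Field F] (g : F →+* NetLimit U ℝ) (φ : Nets hA F) :
    netHom hA g φ = limHom U ℝ fun l => g (φ.1 l) := rfl

theorem netHom_eq_zero {F : Type*} [Field F] {g : F →+* NetLimit U ℝ} {φ : Nets hA F} :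
    netHom hA g φ = 0 ↔ φ ∈ nullIdeal hA U F := by
  rw [netHom_apply, limHom_eq_zero]
  exact Filter.eventually_congr (.of_forall fun l => map_eq_zero g)

/-- The copy of the ultrapower `𝔉(𝔏, F) / I_F` in the field of trees. -/
noncomputable def ultrapowerField {F : Type*} [Field F] (g : F →+* NetLimit U ℝ) :
    Subfield (NetLimit U ℝ) where
  __ := (netHom hA g).range
  inv_mem' := by
    rintro _ ⟨φ, rfl⟩
    obtain ⟨B, hB, h⟩ := φ.2
    refine ⟨⟨φ.1⁻¹, B, hB, fun l => congrArg (·⁻¹) (h l)⟩, ?_⟩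
    rw [netHom_apply, netHom_apply, ← limHom_inv]
    congr 1
    funext l
    exact map_inv₀ g _

theorem mem_ultrapowerField {F : Type*} [Field F] {g : F →+* NetLimit U ℝ} {x : NetLimit U ℝ} :
    x ∈ ultrapowerField hA g ↔ ∃ φ, netHom hA g φ = x := Iff.rfl

/-- Only the range of the map `g` matters for the ultrapower, which is monotone in it. -/
theorem ultrapowerField_mono {F G : Type*} [Field F] [Field G] {f : F →+* NetLimit U ℝ}
    {g : G →+* NetLimit U ℝ} (h : f.fieldRange ≤ g.fieldRange) :
    ultrapowerField hA f ≤ ultrapowerField hA g := by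
  rintro _ ⟨φ, rfl⟩
  obtain ⟨B, hB, hφ⟩ := φ.2
  choose t ht using fun x => h ⟨x, rfl⟩
  refine ⟨⟨fun l => t (φ.1 l), B, hB, fun l => congrArg t (hφ l)⟩, ?_⟩
  rw [netHom_apply, netHom_apply]
  congr 1
  funext l
  exact ht _

theorem ultrapowerField_congr {F G : Type*} [Field F] [Field G] {f : F →+* NetLimit U ℝ}
    {g : G →+* NetLimit U ℝ} (h : f.fieldRange = g.fieldRange) :
    ultrapowerField hA f = ultrapowerField hA g :=
  le_antisymm (ultrapowerField_mono hA h.le) (ultrapowerField_mono hA h.ge)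

theorem ultrapowerField_subtype_mono {K L : Subfield (NetLimit U ℝ)} (h : K ≤ L) :
    ultrapowerField hA K.subtype ≤ ultrapowerField hA L.subtype :=
  ultrapowerField_mono hA (by simpa using h)

/-- The transfinite sequence of iterated ultrapowers of the real numbers, as subfields of the
field of trees: stage `j` is generated by the real numbers and the ultrapowers of the earlier
stages. By `stage_succ` and `stage_limit` it is the ultrapower of its predecessor at a successor,
and the union of the earlier stages at a limit. -/
noncomputable def stage (U : Ultrafilter (FinL A)) (j : Ordinal.{u}) :
    Subfield (NetLimit U ℝ) :=
  (constHom U ℝ).fieldRange ⊔ ⨆ i : Set.Iio j, ultrapowerField hA (stage U i).subtype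
termination_by j
decreasing_by exact i.2

theorem const_le_stage (j : Ordinal.{u}) : (constHom U ℝ).fieldRange ≤ stage hA U j := by
  rw [stage]
  exact le_sup_left

theorem ultrapowerField_le_stage {i j : Ordinal.{u}} (h : i < j) :
    ultrapowerField hA (stage hA U i).subtype ≤ stage hA U j := by
  conv_rhs => rw [stage]
  exact le_sup_of_le_right (le_iSup (fun i : Set.Iio j =>
    ultrapowerField hA (stage hA U i).subtype) ⟨i, h⟩)

theorem stage_le {j : Ordinal.{u}} {L : Subfield (NetLimit U ℝ)}
    (h0 : (constHom U ℝ).fieldRange ≤ L)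
    (h : ∀ i < j, ultrapowerField hA (stage hA U i).subtype ≤ L) : stage hA U j ≤ L := by
  rw [stage]
  exact sup_le h0 (iSup_le fun i => h i i.2)

theorem stage_mono : Monotone (stage hA U) := fun _ _ h =>
  stage_le hA (const_le_stage hA _) fun _ hi => ultrapowerField_le_stage hA (hi.trans_le h)

theorem stage_zero : stage hA U 0 = (constHom U ℝ).fieldRange :=
  le_antisymm (stage_le hA le_rfl fun _ hi => (not_lt_zero hi).elim) (const_le_stage hA _)

theorem netHom_constNet (K : Subfield (NetLimit U ℝ)) (x : K) (hx : x.1 ∈ (constHom U ℝ).range) :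
    netHom hA K.subtype (constNet hA x) = x := by
  obtain ⟨y, hy⟩ := hx
  rw [netHom_apply]
  exact (congrArg _ (funext fun _ => hy.symm)).trans ((limHom_const y).trans hy)

theorem stage_succ (j : Ordinal.{u}) :
    stage hA U (j + 1) = ultrapowerField hA (stage hA U j).subtype := by
  refine le_antisymm (stage_le hA ?_ fun i hi => ?_)
    (ultrapowerField_le_stage hA (Order.lt_succ j))
  · intro x hx
    exact ⟨constNet hA ⟨x, const_le_stage hA j hx⟩, netHom_constNet hA _ _ hx⟩
  · exact ultrapowerField_subtype_mono hA (stage_mono hA (Order.lt_succ_iff.1 hi))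

theorem stage_limit {k : Ordinal.{u}} (hk : Order.IsSuccLimit k) :
    (stage hA U k : Set (NetLimit U ℝ)) = ⋃ j < k, (stage hA U j : Set (NetLimit U ℝ)) := by
  have hne : Nonempty (Set.Iio k) := ⟨⟨0, hk.bot_lt⟩⟩
  have e : stage hA U k = ⨆ j : Set.Iio k, stage hA U j := by
    refine le_antisymm (stage_le hA ?_ fun i hi => ?_)
      (iSup_le fun j => stage_mono hA (le_of_lt j.2))
    · exact (const_le_stage hA 0).trans
        (le_iSup (fun j : Set.Iio k => stage hA U j) ⟨0, hk.bot_lt⟩)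
    · rw [← stage_succ]
      exact le_iSup (fun j : Set.Iio k => stage hA U j) ⟨i + 1, hk.succ_lt hi⟩
  have hd : Directed (· ≤ ·) fun j : Set.Iio k => stage hA U j :=
    Monotone.directed_le fun _ _ h => stage_mono hA h
  rw [e, Subfield.coe_iSup_of_directed hd, Set.iUnion_subtype]
  rfl

end Stages

/-! ### Cardinalities -/

section Card

open Cardinal

/-- `κ ^ {<κ} = κ`, for the subsets of size less than `κ`. -/
theorem mk_small_subsets_le (hA : (#A).IsInaccessible) {α : Type (u + 1)}
    (hα : #α ≤ lift.{u + 1} #A) : #{s : Set α // #s < lift.{u + 1} #A} ≤ lift.{u + 1} #A := by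
  obtain ⟨e⟩ := lift_mk_le'.1 ((lift_id'.{u, u + 1} #α).trans_le hα)
  have h := mk_subset_mk_lt_cof (α := A) hA.isStrongPrelimit
  rw [hA.isRegular.cof_ord] at h
  refine (lift_id'.{u, u + 1} #{s : Set α // #s < lift.{u + 1} #A}).symm.trans_le
    (le_trans ?_ (congrArg lift.{u + 1} h).le)
  refine lift_mk_le'.2 ⟨⟨fun s => ⟨e '' s.1, ?_⟩, fun s t hst => ?_⟩⟩
  · rw [← lift_lt.{u, u + 1}, mk_image_eq_lift _ _ e.injective, lift_id'.{u, u + 1}]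
    exact s.2
  · exact Subtype.ext (e.injective.image_injective (congrArg Subtype.val hst))

theorem two_power_lt_lift (hA : (#A).IsInaccessible) {c : Cardinal.{u + 1}}
    (hc : c < lift.{u + 1} #A) : 2 ^ c < lift.{u + 1} #A := by
  obtain ⟨d, hd, rfl⟩ := lt_lift_iff.1 hc
  rw [← lift_two_power, lift_lt]
  exact hA.isStrongPrelimit hd

theorem aleph0_le_lift (hA : (#A).IsInaccessible) : ℵ₀ ≤ lift.{u + 1} #A := (aleph0_lt_lift hA).le

theorem mk_level_le (hA : (#A).IsInaccessible) (n : ℕ) :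
    #{x : Obj A | x ∈ V (Set.range atom) n ∧ HereditarilySmall x} ≤ lift.{u + 1} #A := by
  induction n with
  | zero =>
    refine (mk_le_mk_of_subset fun x hx => hx.1).trans ?_
    have := mk_range_le_lift (f := (atom : A → Obj A))
    rwa [lift_id'.{u, u + 1}] at this
  | succ n ih =>
    set S := {x : Obj A | x ∈ V (Set.range atom) n ∧ HereditarilySmall x}
    set T := {x : Obj A | IsSet x ∧ ext x ⊆ V (Set.range atom) n ∧ HereditarilySmall x}
    have hT : #T ≤ lift.{u + 1} #A := by
      refine le_trans (mk_le_of_injective (f := fun x : T =>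
        (⟨Subtype.val ⁻¹' ext x.1, ?_⟩ : {s : Set S // #s < lift.{u + 1} #A})) ?_)
        (mk_small_subsets_le hA ih)
      · exact (mk_preimage_of_injective _ _ Subtype.val_injective).trans_lt x.2.2.2.card
      · intro x y hxy
        have key : ∀ x : T, Subtype.val '' (Subtype.val ⁻¹' ext x.1 : Set S) = ext x.1 := by
          intro x
          rw [Subtype.image_preimage_coe, Set.inter_eq_right]
          exact fun y hy => ⟨x.2.2.1 hy, x.2.2.2.elem y hy⟩
        refine Subtype.ext (x.2.1.eq_of_ext_eq y.2.1 ?_)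
        rw [← key x, ← key y]
        exact congrArg (fun s => Subtype.val '' s.1) hxy
    refine (mk_le_mk_of_subset (t := S ∪ T) ?_).trans ((mk_union_le _ _).trans
      (add_le_of_le (aleph0_le_lift hA) ih hT))
    rintro x ⟨hx | hx, h⟩
    · exact Or.inl ⟨hx, h⟩
    · exact Or.inr ⟨hx.1, hx.2, h⟩

theorem mk_Lam_le (hA : (#A).IsInaccessible) : #(Lam A) ≤ lift.{u + 1} #A := by
  have e : Lam A = ⋃ n, {x : Obj A | x ∈ V (Set.range atom) n ∧ HereditarilySmall x} := by
    ext x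
    simp [Lam, VA]
  rw [e]
  have h := mk_iUnion_le_lift fun n => {x : Obj A | x ∈ V (Set.range atom) n ∧ HereditarilySmall x}
  rw [lift_id'.{0, u + 1}] at h
  refine h.trans (mul_le_of_le (aleph0_le_lift hA) ?_ (ciSup_le' fun n => ?_))
  · simpa using aleph0_le_lift hA
  · rw [lift_id'.{0, u + 1}]
    exact mk_level_le hA n

theorem mk_LamS_le (hA : (#A).IsInaccessible) : #(LamS A) ≤ lift.{u + 1} #A :=
  (mk_le_mk_of_subset fun _ h => h.1).trans (mk_Lam_le hA)

theorem mk_FinL_le (hA : (#A).IsInaccessible) : #(FinL A) ≤ lift.{u + 1} #A :=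
  (mk_le_mk_of_subset fun _ h => h.1).trans (mk_LamS_le hA)

/-- Since `κ` is a strong limit, a set in `Λ_S` has fewer than `κ` traces `λ ∩ B`. -/
theorem mk_traces_lt (hA : (#A).IsInaccessible) {B : Obj A} (hB : B ∈ LamS A) :
    #(Set.range fun l : FinL A => FinL.inter l B) < lift.{u + 1} #A := by
  refine lt_of_le_of_lt ?_ (two_power_lt_lift hA hB.1.2.card)
  rw [← mk_set]
  refine mk_le_of_injective (f := fun l : Set.range fun l : FinL A => FinL.inter l B =>
    (Subtype.val ⁻¹' ext l.1.1 : Set (ext B))) ?_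
  rintro ⟨_, l, rfl⟩ ⟨_, m, rfl⟩ h
  refine Subtype.ext (Subtype.ext (IsSet.eq_of_ext_eq (FinL.inter l B).2.1.2
    (FinL.inter m B).2.1.2 ?_))
  have key : ∀ l : FinL A, Subtype.val '' (Subtype.val ⁻¹' ext (FinL.inter l B).1 : Set (ext B)) =
      ext (FinL.inter l B).1 := by
    intro l
    rw [Subtype.image_preimage_coe, Set.inter_eq_right, FinL.ext_inter]
    exact Set.inter_subset_right
  rw [← key l, ← key m]
  exact congrArg _ h

/-- A net with values in `K` is coded by a bound `B ∈ Λ_S` and by its graph on the traces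
`λ ∩ B`, which is a set of size less than `κ`. -/
theorem mk_Nets_le (hA : (#A).IsInaccessible) {K : Type (u + 1)} [CommRing K]
    (hK : #K ≤ lift.{u + 1} #A) : #(Nets hA K) ≤ lift.{u + 1} #A := by
  have hP : #(FinL A × K) ≤ lift.{u + 1} #A := by
    rw [mk_prod, lift_id, lift_id]
    exact mul_le_of_le (aleph0_le_lift hA) (mk_FinL_le hA) hK
  have hQ : #(LamS A × {s : Set (FinL A × K) // #s < lift.{u + 1} #A}) ≤ lift.{u + 1} #A := by
    rw [mk_prod, lift_id, lift_id]
    exact mul_le_of_le (aleph0_le_lift hA) (mk_LamS_le hA) (mk_small_subsets_le hA hP)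
  choose B hB hφ using fun φ : Nets hA K => φ.2
  let G (φ : Nets hA K) : Set (FinL A × K) := Set.range fun l => (FinL.inter l (B φ), φ.1 l)
  have hG : ∀ φ, #(G φ) < lift.{u + 1} #A := fun φ => by
    refine lt_of_le_of_lt ?_ (mk_traces_lt hA (hB φ))
    refine mk_le_of_injective (f := fun p : G φ =>
      (⟨p.1.1, ?_⟩ : Set.range fun l : FinL A => FinL.inter l (B φ))) ?_
    · obtain ⟨l, hl⟩ := p.2
      exact ⟨l, congrArg Prod.fst hl⟩
    · rintro ⟨_, l, rfl⟩ ⟨_, m, rfl⟩ h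
      have h' : FinL.inter l (B φ) = FinL.inter m (B φ) := congrArg Subtype.val h
      refine Subtype.ext (Prod.ext h' ?_)
      change φ.1 l = φ.1 m
      rw [hφ φ l, hφ φ m, h']
  refine (mk_le_of_injective (f := fun φ => ((⟨B φ, hB φ⟩, ⟨G φ, hG φ⟩) :
    LamS A × {s : Set (FinL A × K) // #s < lift.{u + 1} #A})) fun φ ψ h => ?_).trans hQ
  have h1 : B φ = B ψ := congrArg (fun p => p.1.1) h
  have h2 : G φ = G ψ := congrArg (fun p => p.2.1) h
  refine Subtype.ext (funext fun l => ?_)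
  -- The trace of `m` on the common bound is that of `l`, so the two nets agree at `l`.
  obtain ⟨m, hm⟩ : (FinL.inter l (B φ), φ.1 l) ∈ G ψ := h2 ▸ ⟨l, rfl⟩
  have hm1 : FinL.inter m (B ψ) = FinL.inter l (B φ) := congrArg Prod.fst hm
  have hm2 : ψ.1 m = φ.1 l := congrArg Prod.snd hm
  rw [← hm2, hφ ψ m, hm1, h1, ← hφ ψ l]

theorem mk_stage_le (hA : (#A).IsInaccessible) (r : ℝ ↪ A) {U : Ultrafilter (FinL A)}
    (j : Ordinal.{u}) (hj : j ≤ (#A).ord) : #(stage hA U j) ≤ lift.{u + 1} #A := by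
  induction j using Ordinal.limitRecOn with
  | zero =>
    rw [stage_zero]
    have h := mk_range_le_lift (f := NetLimit.constHom U ℝ)
    rw [lift_id'.{0, u + 1}] at h
    refine h.trans ?_
    have h' := lift_mk_le'.2 ⟨r⟩
    rw [lift_id'.{0, u}] at h'
    simpa using lift_le.{u + 1}.2 h'
  | add_one j ih =>
    have ih := ih ((Order.le_succ j).trans hj)
    rw [stage_succ]
    refine le_trans ?_ (mk_Nets_le hA ih)
    exact mk_le_of_surjective (f := fun φ => (⟨netHom hA (stage hA U j).subtype φ, φ, rfl⟩ :
      ultrapowerField hA (stage hA U j).subtype)) fun ⟨_, φ, h⟩ => ⟨φ, Subtype.ext h⟩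
  | limit k hk ih =>
    have e : #(stage hA U k) = #(stage hA U k : Set (NetLimit U ℝ)) := rfl
    rw [e, stage_limit hA hk]
    change #(⋃ j ∈ Set.Iio k, (stage hA U j : Set (NetLimit U ℝ)) : Set _) ≤ _
    rw [Set.biUnion_eq_iUnion]
    refine (mk_iUnion_le _).trans (mul_le_of_le (aleph0_le_lift hA) ?_ (ciSup_le' fun i => ?_))
    · rw [Cardinal.mk_Iio_ordinal, lift_le]
      exact (Ordinal.card_le_card hj).trans (card_ord _).le
    · exact ih i i.2 (le_of_lt (i.2.trans_le hj))

/-- A set of size at most `κ` that contains a copy of `ℝ` embeds into the atoms, over `r`. -/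
theorem exists_embedding (hA : (#A).IsInaccessible) (r : ℝ ↪ A) {α : Type (u + 1)}
    (hα : #α ≤ lift.{u + 1} #A) {c : ℝ → α} (hc : Function.Injective c) :
    ∃ f : α ↪ A, ∀ x, f (c x) = r x := by
  classical
  have : Infinite A := infinite_iff.2 hA.aleph0_lt.le
  have hr : #(Set.range r) < #A := by
    have h := mk_range_eq_of_injective r.injective
    rw [mk_real, lift_continuum, lift_uzero] at h
    rw [h, ← two_power_aleph0]
    exact hA.isStrongPrelimit hA.aleph0_lt
  have h : lift.{u} #α ≤ lift.{u + 1} #((Set.range r)ᶜ : Set A) := by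
    rwa [mk_compl_of_infinite _ hr, lift_id'.{u, u + 1}]
  obtain ⟨g⟩ := lift_mk_le'.1 h
  refine ⟨⟨fun x => if h : ∃ y, c y = x then r h.choose else g x, fun x y hxy => ?_⟩, fun x => ?_⟩
  · dsimp only at hxy
    -- In the mixed cases an atom of the range of `r` would equal one of its complement.
    split_ifs at hxy with h1 h2 h2
    · rw [← h1.choose_spec, ← h2.choose_spec, r.injective hxy]
    · exact ((g y).2 ⟨_, hxy⟩).elim
    · exact ((g x).2 ⟨_, hxy.symm⟩).elim
    · exact g.injective (Subtype.ext hxy)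
  · have h : ∃ y, c y = c x := ⟨x, rfl⟩
    change dite _ _ _ = _
    rw [dif_pos h, hc h.choose_spec]

end Card

/-! ### Existence of the tower -/

section TowerExists

open NetLimit

variable {hA : (Cardinal.mk A).IsInaccessible} {r : ℝ ↪ A} {U : Ultrafilter (FinL A)}

/-- The last stage becomes a tower as soon as it is copied, over `r`, onto an ordered field whose
elements are atoms. -/
theorem nonempty_tower_of_orderIso (E : Set A) [Field E] [LinearOrder E] [IsStrictOrderedRing E]
    (e : E ≃+* stage hA U (Cardinal.mk A).ord) (hle : ∀ x y, e x ≤ e y ↔ x ≤ y)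
    (hr : ∀ x, ∃ h : r x ∈ E, (e ⟨r x, h⟩ : NetLimit U ℝ) = constHom U ℝ x) :
    Nonempty (Tower hA r U) := by
  classical
  let g : E →+* NetLimit U ℝ := (stage hA U (Cardinal.mk A).ord).subtype.comp e.toRingHom
  have hg_inj : Function.Injective g := g.injective
  have hg_le : ∀ x y, g x ≤ g y ↔ x ≤ y := hle
  have hg_mem : ∀ z ∈ stage hA U (Cardinal.mk A).ord, ∃ x, g x = z := fun z hz =>
    ⟨e.symm ⟨z, hz⟩, congrArg Subtype.val (e.apply_symm_apply ⟨z, hz⟩)⟩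
  have hg_range : ∀ x, g x ∈ stage hA U (Cardinal.mk A).ord := fun x => (e x).2
  let K (j : Ordinal.{u}) : Subfield E := (stage hA U j).comap g
  have hK : ∀ j < (Cardinal.mk A).ord,
      ultrapowerField hA (g.comp (K j).subtype) = stage hA U (j + 1) := by
    intro j hj
    rw [stage_succ]
    refine ultrapowerField_congr hA (le_antisymm ?_ fun z hz => ?_)
    · rintro _ ⟨x, rfl⟩
      exact ⟨⟨_, x.2⟩, rfl⟩
    · obtain ⟨z, rfl⟩ := hz
      obtain ⟨x, hx⟩ := hg_mem z.1 (stage_mono hA hj.le z.2)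
      exact ⟨⟨x, show g x ∈ stage hA U j from hx ▸ z.2⟩, hx⟩
  have hsucc : ∀ j < (Cardinal.mk A).ord, j + 1 ≤ (Cardinal.mk A).ord := fun j hj =>
    Order.succ_le_of_lt hj
  let Θ (j : Ordinal.{u}) (hj : j < (Cardinal.mk A).ord) : Ultrapower hA U (K j) →+* E :=
    Ideal.Quotient.lift _ ((e.symm.toRingHom).comp
      ((netHom hA (g.comp (K j).subtype)).codRestrict (stage hA U (Cardinal.mk A).ord)
        fun φ => stage_mono hA (hsucc j hj) (hK j hj ▸ ⟨φ, rfl⟩)))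
      fun φ hφ => by
        rw [RingHom.comp_apply]
        refine (congrArg _ (Subtype.ext ?_)).trans (map_zero _)
        exact (netHom_eq_zero hA).2 hφ
  have hΘ : ∀ j hj (φ : Nets hA (K j)),
      g (Θ j hj (Ideal.Quotient.mk _ φ)) = limHom U ℝ fun l => g (φ.1 l) := by
    intro j hj φ
    exact congrArg Subtype.val (e.apply_symm_apply _)
  choose hrE hre using hr
  have hconst : ∀ x, g ⟨r x, hrE x⟩ = constHom U ℝ x := hre
  let real : ℝ →+*o E :=
    { toFun := fun x => ⟨r x, hrE x⟩
      map_zero' := hg_inj (by rw [hconst, map_zero, map_zero])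
      map_one' := hg_inj (by rw [hconst, map_one, map_one])
      map_add' := fun x y => hg_inj (by
        rw [map_add g, hconst x, hconst y, ← map_add, ← hconst])
      map_mul' := fun x y => hg_inj (by
        rw [map_mul g, hconst x, hconst y, ← map_mul, ← hconst])
      monotone' := fun x y h => by
        rw [← hg_le]
        exact (hconst x).trans_le ((constHom_le.2 h).trans_eq (hconst y).symm) }
  exact ⟨
    { E := E
      K := K
      mono := fun i j hij _ x hx => stage_mono hA hij hx
      real := real
      real_eq := fun x => rfl
      zero_eq := by
        ext x
        change g x ∈ stage hA U 0 ↔ _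
        rw [stage_zero]
        constructor
        · rintro ⟨y, hy⟩
          exact ⟨y, hg_inj ((hconst y).trans hy)⟩
        · rintro ⟨y, rfl⟩
          exact ⟨y, (hconst y).symm⟩
      Θ := Θ
      Θ_injective := fun j hj => by
        intro a b hab
        obtain ⟨φ, rfl⟩ := Ideal.Quotient.mk_surjective a
        obtain ⟨ψ, rfl⟩ := Ideal.Quotient.mk_surjective b
        rw [Ideal.Quotient.eq, ← netHom_eq_zero hA (g := g.comp (K j).subtype), map_sub,
          sub_eq_zero]
        exact (hΘ j hj φ).symm.trans ((congrArg g hab).trans (hΘ j hj ψ))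
      Θ_range := fun j hj => by
        ext x
        change _ ↔ g x ∈ stage hA U (j + 1)
        rw [← hK j hj, mem_ultrapowerField]
        constructor
        · rintro ⟨a, rfl⟩
          obtain ⟨φ, rfl⟩ := Ideal.Quotient.mk_surjective a
          exact ⟨φ, (hΘ j hj φ).symm⟩
        · rintro ⟨φ, hφ⟩
          exact ⟨Ideal.Quotient.mk _ φ, hg_inj ((hΘ j hj φ).trans hφ)⟩
      Θ_le_iff := fun j hj φ ψ => by
        rw [← hg_le, hΘ j hj, hΘ j hj, limHom_le_iff]
        exact Filter.eventually_congr (.of_forall fun l => hg_le _ _)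
      Θ_const := fun h0 x => by
        refine hg_inj ((hΘ 0 h0 _).trans ?_)
        obtain ⟨y, hy⟩ : g x ∈ (constHom U ℝ).fieldRange := stage_zero hA (U := U) ▸ x.2
        exact (congrArg (limHom U ℝ) (funext fun _ => hy.symm)).trans ((limHom_const y).trans hy)
      Θ_coherent := fun i j hi hj _ φ ψ h => by
        refine hg_inj ((hΘ i hi φ).trans (.trans ?_ (hΘ j hj ψ).symm))
        exact congrArg (limHom U ℝ) (funext fun l => congrArg g (h l))
      limit_eq := fun k hk _ => by
        change g ⁻¹' (stage hA U k : Set (NetLimit U ℝ)) = _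
        rw [stage_limit hA hk, Set.preimage_iUnion₂]
        rfl
      top_eq := eq_top_iff.2 fun x _ => hg_range x
      -- The limit of a net `ψ` that is not a net over any `K j` with `j < κ` is irrelevant.
      J := fun ψ =>
        if h : (limHom U ℝ fun l => g (ψ.1 l)) ∈ stage hA U (Cardinal.mk A).ord then
          e.symm ⟨_, h⟩ else 0
      J_eq := fun j hj φ ψ h => by
        have hψ : (limHom U ℝ fun l => g (ψ.1 l)) = g (Θ j hj (Ideal.Quotient.mk _ φ)) :=
          .trans (congrArg (limHom U ℝ) (funext fun l => congrArg g (h l).symm)) (hΘ j hj φ).symm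
        have hmem : (limHom U ℝ fun l => g (ψ.1 l)) ∈ stage hA U (Cardinal.mk A).ord :=
          hψ ▸ hg_range _
        rw [dif_pos hmem]
        refine hg_inj (.trans ?_ hψ)
        exact congrArg Subtype.val (e.apply_symm_apply _) }⟩

theorem nonempty_tower : Nonempty (Tower hA r U) := by
  let L := stage hA U (Cardinal.mk A).ord
  let c : ℝ → L := fun x => ⟨constHom U ℝ x, const_le_stage hA _ ⟨x, rfl⟩⟩
  obtain ⟨f, hf⟩ := exists_embedding hA r (mk_stage_le hA r (U := U) _ le_rfl) (c := c)
    fun x y h => (constHom U ℝ).injective (congrArg Subtype.val h)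
  let e : Set.range f ≃ L := (Equiv.ofInjective f f.injective).symm
  let : Field (Set.range f) := e.field
  let : LinearOrder (Set.range f) := LinearOrder.lift' e e.injective
  have hle : ∀ x y, e x ≤ e y ↔ x ≤ y := fun _ _ => Iff.rfl
  have hlt : ∀ {x y}, e x < e y ↔ x < y := lt_iff_lt_of_le_iff_le' (hle _ _) (hle _ _)
  let e' : Set.range f ≃+* L := e.ringEquiv
  have : IsStrictOrderedRing (Set.range f) :=
    Function.Injective.isStrictOrderedRing e' (map_zero e') (map_one e') (map_add e')
      (map_mul e') (hle _ _) hlt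
  refine nonempty_tower_of_orderIso (Set.range f) e' hle fun x => ⟨⟨c x, hf x⟩, ?_⟩
  have : (⟨r x, c x, hf x⟩ : Set.range f) = e.symm (c x) := Subtype.ext (hf x).symm
  rw [this]
  exact congrArg Subtype.val (e.apply_symm_apply (c x))

end TowerExists

/-! ### Existence of admissible ultrafilters -/

section Admissible

/-- Collections that contain all elements of the finite sets they contain. Such a collection also
contains the components of the Kuratowski pairs it contains. -/
def FinClosed (S : Set (Obj A)) : Prop := ∀ y ∈ S, (ext y).Finite → ext y ⊆ S

theorem ext_single (a : Obj A) : ext (single a) = {a} := ext_mkSet _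

theorem ext_opair (a b : Obj A) : ext (opair a b) = {single a, mkSet {a, b}} := ext_mkSet _

theorem FinClosed.of_opair_mem {S : Set (Obj A)} (hS : FinClosed S) {a b : Obj A}
    (h : opair a b ∈ S) : a ∈ S ∧ b ∈ S := by
  have h1 : mkSet {a, b} ∈ S := hS _ h (by rw [ext_opair]; exact Set.toFinite _)
    (by rw [ext_opair]; exact Or.inr rfl)
  have h2 : ext (mkSet {a, b}) ⊆ S := hS _ h1 (by rw [ext_mkSet]; exact Set.toFinite _)
  rw [ext_mkSet] at h2
  exact ⟨h2 (Or.inl rfl), h2 (Or.inr rfl)⟩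

theorem FinClosed.V {S : Set (Obj A)} (hS : FinClosed S) (n : ℕ) :
    FinClosed (EuclideanUniverse.V S n) := by
  induction n with
  | zero => exact hS
  | succ n ih =>
    rintro y (hy | hy) hf
    · exact (ih y hy hf).trans (V_succ S n)
    · exact hy.2.trans (V_succ S n)

theorem FinClosed.biUnion {ι : Type*} {s : Set ι} {S : ι → Set (Obj A)}
    (hS : ∀ i ∈ s, FinClosed (S i)) : FinClosed (⋃ i ∈ s, S i) := by
  intro y hy hf
  obtain ⟨i, hi, hyi⟩ := Set.mem_iUnion₂.1 hy
  exact (hS i hi y hyi hf).trans (Set.subset_biUnion_of_mem hi)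

/-- By induction along the membership relation, closing off under the elements of finite sets is a
finite process. -/
theorem exists_finite_finClosed {x : Obj A} (hx : HereditarilySmall x) {n : ℕ}
    (hn : x ∈ V (Set.range atom) n) :
    ∃ S : Set (Obj A), x ∈ S ∧ S.Finite ∧ FinClosed S ∧ S ⊆ V (Set.range atom) n ∧
      ∀ y ∈ S, HereditarilySmall y := by
  induction hx with
  | intro x hx h ih =>
    by_cases hf : (ext x).Finite
    · choose! S h1 h2 h3 h4 h5 using fun y hy => ih y hy (ext_subset_V hn hy)
      refine ⟨insert x (⋃ y ∈ ext x, S y), Set.mem_insert _ _, (hf.biUnion h2).insert x, ?_, ?_, ?_⟩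
      · rintro y (rfl | hy) hy'
        · exact fun z hz => Or.inr (Set.mem_biUnion hz (h1 z hz))
        · exact (FinClosed.biUnion h3 y hy hy').trans (Set.subset_insert _ _)
      · exact Set.insert_subset hn (Set.iUnion₂_subset h4)
      · rintro y (rfl | hy)
        · exact .intro _ hx h
        · obtain ⟨z, hz, hyz⟩ := Set.mem_iUnion₂.1 hy
          exact h5 z hz y hyz
    · exact ⟨{x}, rfl, Set.finite_singleton x, by rintro y rfl hy; exact (hf hy).elim,
        Set.singleton_subset_iff.2 hn, by rintro y rfl; exact .intro _ hx h⟩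

theorem finite_V {S : Set (Obj A)} (hS : S.Finite) (n : ℕ) : (V S n).Finite := by
  induction n with
  | zero => exact hS
  | succ n ih =>
    refine ih.union (Set.Finite.of_finite_image (f := ext) (ih.finite_subsets.subset ?_) ?_)
    · rintro _ ⟨y, hy, rfl⟩
      exact hy.2
    · intro x hx y hy h
      exact hx.1.eq_of_ext_eq hy.1 h

theorem V_subset_V {S : Set (Obj A)} {m : ℕ} (hS : S ⊆ V (Set.range atom) m) (n : ℕ) :
    V S n ⊆ V (Set.range atom) (m + n) := by
  induction n with
  | zero => exact hS
  | succ n ih =>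
    rintro y (hy | hy)
    · exact Or.inl (ih hy)
    · exact Or.inr ⟨hy.1, hy.2.trans ih⟩

theorem HereditarilySmall.of_finite (hA : (Cardinal.mk A).IsInaccessible) {x : Obj A}
    (hf : (ext x).Finite) (h : ∀ y ∈ ext x, HereditarilySmall y) : HereditarilySmall x :=
  .intro x ((Cardinal.lt_aleph0_iff_set_finite.2 hf).trans (aleph0_lt_lift hA)) h

theorem hereditarilySmall_of_mem_V (hA : (Cardinal.mk A).IsInaccessible) {S : Set (Obj A)}
    (hf : S.Finite) (hS : ∀ y ∈ S, HereditarilySmall y) (n : ℕ) :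
    ∀ y ∈ V S n, HereditarilySmall y := by
  induction n with
  | zero => exact hS
  | succ n ih =>
    rintro y (hy | hy)
    · exact ih y hy
    · exact .of_finite hA ((finite_V hf n).subset hy.2) fun z hz => ih z (hy.2 hz)

/-- The finite collections of elements of `Λ`, bounded in rank, are the extensions of the elements
of `𝔏`. -/
theorem exists_FinL (hA : (Cardinal.mk A).IsInaccessible) {S : Set (Obj A)} (hf : S.Finite) {n : ℕ}
    (hn : S ⊆ V (Set.range atom) n) (hS : ∀ y ∈ S, HereditarilySmall y) :
    ∃ l : FinL A, ext l.1 = S := by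
  have := hf.to_subtype
  have : Small.{u} S := inferInstance
  refine ⟨⟨mkSet S, finite_mem_LamS hA hf n hn hS, ?_⟩, ext_mkSet S⟩
  rwa [ext_mkSet]

theorem Q_inter_pairClosed_nonempty (hA : (Cardinal.mk A).IsInaccessible) (n : ℕ) (l : FinL A) :
    (Q n l ∩ pairClosed A).Nonempty := by
  obtain ⟨m, hm⟩ := l.2.1.1.1
  choose! S h1 h2 h3 h4 h5 using fun y (hy : y ∈ ext l.1) =>
    exists_finite_finClosed (l.2.1.1.2.elem y hy) (ext_subset_V hm hy)
  have hf : (⋃ y ∈ ext l.1, S y).Finite := l.2.2.biUnion h2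
  have hV : (⋃ y ∈ ext l.1, S y) ⊆ V (Set.range atom) m := Set.iUnion₂_subset h4
  have hh : ∀ z ∈ ⋃ y ∈ ext l.1, S y, HereditarilySmall z := by
    intro z hz
    obtain ⟨y, hy, hzy⟩ := Set.mem_iUnion₂.1 hz
    exact h5 y hy z hzy
  obtain ⟨l', hl'⟩ := exists_FinL hA hf hV hh
  obtain ⟨k, hk⟩ := exists_FinL hA (finite_V hf n) (V_subset_V hV n)
    (hereditarilySmall_of_mem_V hA hf hh n)
  refine ⟨k, ⟨n, le_rfl, l', ?_, hk.trans (by rw [hl'])⟩, fun a b hab => ?_⟩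
  · rw [hl']
    exact fun y hy => Set.mem_biUnion hy (h1 y hy)
  · rw [hk] at hab ⊢
    exact ((FinClosed.biUnion h3).V n).of_opair_mem hab

theorem Q_anti {n n' : ℕ} {l l' : FinL A} (hn : n ≤ n') (hl : ext l.1 ⊆ ext l'.1) :
    Q n' l' ⊆ Q n l := by
  rintro m ⟨k, hk, t, ht, hm⟩
  exact ⟨k, hn.trans hk, t, hl.trans ht, hm⟩

theorem exists_FinL_union (hA : (Cardinal.mk A).IsInaccessible) (l l' : FinL A) :
    ∃ m : FinL A, ext l.1 ∪ ext l'.1 = ext m.1 := by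
  have e : ext (union l.1 l'.1) = ext l.1 ∪ ext l'.1 := ext_mkSet _
  exact ⟨⟨union l.1 l'.1, union_mem hA l.2.1 l'.2.1, e ▸ l.2.2.union l'.2.2⟩, e.symm⟩

theorem exists_admissible (hA : (Cardinal.mk A).IsInaccessible) :
    ∃ U : Ultrafilter (FinL A), Admissible U := by
  obtain ⟨l₀, -⟩ := exists_FinL hA (Set.finite_empty (α := Obj A)) (n := 0) (Set.empty_subset _)
    (by simp)
  have hne : Nonempty (FinL A) := ⟨l₀⟩
  let F (p : ℕ × FinL A) : Filter (FinL A) := Filter.principal (Q p.1 p.2 ∩ pairClosed A)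
  have hF : (⨅ p, F p).NeBot := by
    refine Filter.iInf_neBot_of_directed ?_ fun p =>
      Filter.principal_neBot_iff.2 (Q_inter_pairClosed_nonempty hA p.1 p.2)
    rintro ⟨n, l⟩ ⟨n', l'⟩
    obtain ⟨m, hm⟩ := exists_FinL_union hA l l'
    refine ⟨(max n n', m), ?_, ?_⟩
    · exact Filter.principal_mono.2 (Set.inter_subset_inter_left _
        (Q_anti (le_max_left n n') (Set.subset_union_left.trans_eq hm)))
    · exact Filter.principal_mono.2 (Set.inter_subset_inter_left _
        (Q_anti (le_max_right n n') (Set.subset_union_right.trans_eq hm)))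
  have key : ∀ p : ℕ × FinL A, Q p.1 p.2 ∩ pairClosed A ∈ Ultrafilter.of (⨅ p, F p) := fun p =>
    Ultrafilter.of_le _ (iInf_le F p (Filter.mem_principal_self _))
  exact ⟨_, fun n l => Filter.mem_of_superset (key (n, l)) Set.inter_subset_left,
    Filter.mem_of_superset (key (0, l₀)) Set.inter_subset_right⟩

end Admissible

/-! ### Numerosities -/

section Numerosity

variable {hA : (Cardinal.mk A).IsInaccessible} {r : ℝ ↪ A} {U : Ultrafilter (FinL A)}

theorem opair_injective {a b c d : Obj A} (h : opair a b = opair c d) : a = c ∧ b = d := by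
  have h1 := congrArg (fun x => ext '' ext x) h
  simp only [ext_opair, Set.image_pair, ext_single, ext_mkSet] at h1
  simp only [Set.pair_eq_pair_iff, Set.singleton_eq_singleton_iff] at h1
  rcases h1 with ⟨h1, h2⟩ | ⟨h1, h2⟩
  · subst h1
    rcases h2 with ⟨-, h2⟩ | ⟨h2, h3⟩
    · exact ⟨rfl, h2⟩
    · exact ⟨rfl, h3.trans h2⟩
  · have h3 : c = a := by
      have : c ∈ ({a} : Set (Obj A)) := h1 ▸ Or.inl rfl
      exact this
    have h4 : d = a := by
      have : d ∈ ({a} : Set (Obj A)) := h1 ▸ Or.inr rfl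
      exact this
    have h5 : b = c := by
      have : b ∈ ({c} : Set (Obj A)) := h2 ▸ Or.inr rfl
      exact this
    exact ⟨h3.symm, h5.trans (h3.trans h4.symm)⟩

theorem mem_of_atom_mem_V {l : Set (Obj A)} {a : A} {n : ℕ} (h : atom a ∈ V l n) :
    atom a ∈ l := by
  induction n with
  | zero => exact h
  | succ n ih => exact h.elim ih fun h => (h.1 a rfl).elim

/-- The objects of rank at most `m` of the levels `V_n(λ)` all appear at level `m`. -/
theorem mem_V_of_rank_le {l : Set (Obj A)} (m n : ℕ) {a : Obj A}
    (ha : a ∈ V (Set.range atom) m) (h : a ∈ V l n) : a ∈ V l m := by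
  induction m generalizing n a with
  | zero =>
    obtain ⟨a, rfl⟩ := ha
    exact mem_of_atom_mem_V h
  | succ m ih =>
    rcases ha with ha | ha
    · exact V_succ l m (ih n ha h)
    · induction n with
      | zero => exact V_mono l (Nat.zero_le _) h
      | succ n ihn =>
        rcases h with h | h
        · exact ihn h
        · exact Or.inr ⟨h.1, fun y hy => ih n (ha.2 hy) (h.2 hy)⟩

theorem opair_mem_V {l : Set (Obj A)} {n : ℕ} {a b : Obj A} (ha : a ∈ V l n) (hb : b ∈ V l n) :
    opair a b ∈ V l (n + 2) := by
  refine Or.inr ⟨isSet_mkSet _, ?_⟩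
  rw [ext_opair]
  rintro y (rfl | rfl)
  · exact Or.inr ⟨isSet_mkSet _, by rw [ext_single]; simpa using ha⟩
  · exact Or.inr ⟨isSet_mkSet _, by rw [ext_mkSet]; rintro y (rfl | rfl) <;> assumption⟩

theorem eventually_mem (hA : (Cardinal.mk A).IsInaccessible) (hU : Admissible U)
    {a : Obj A} (ha : a ∈ Lam A) :
    ∀ᶠ l in (U : Filter (FinL A)), a ∈ ext l.1 := by
  have hs : single a ∈ FinL A :=
    ⟨single_mem hA ha, by rw [ext_single]; exact Set.finite_singleton a⟩
  filter_upwards [hU.1 0 ⟨single a, hs⟩] with m ⟨n, _, l, hl, hm⟩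
  rw [hm]
  refine V_mono _ (Nat.zero_le n) (hl ?_)
  change a ∈ ext (single a)
  rw [ext_single]
  rfl

/-- Almost all `λ` contain a pair of elements of `X` and `Y` exactly if they contain its
components. -/
theorem eventually_opair_mem_iff (hA : (Cardinal.mk A).IsInaccessible) (hU : Admissible U)
    (X Y : LamS A) :
    ∀ᶠ l in (U : Filter (FinL A)), ∀ a ∈ ext X.1, ∀ b ∈ ext Y.1,
      opair a b ∈ ext l.1 ↔ a ∈ ext l.1 ∧ b ∈ ext l.1 := by
  obtain ⟨i, hi⟩ := X.2.1.1
  obtain ⟨j, hj⟩ := Y.2.1.1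
  obtain ⟨l₀, -⟩ := exists_FinL (A := A) hA (Set.finite_empty) (n := 0) (Set.empty_subset _)
    (by simp)
  filter_upwards [hU.2, hU.1 (max i j + 2) l₀] with m hm ⟨n, hn, l, _, hl⟩ a ha b hb
  refine ⟨hm a b, fun h => ?_⟩
  rw [hl] at h ⊢
  exact V_mono _ hn (opair_mem_V
    (mem_V_of_rank_le _ n (V_mono _ (le_max_left i j) (ext_subset_V hi ha)) h.1)
    (mem_V_of_rank_le _ n (V_mono _ (le_max_right i j) (ext_subset_V hj hb)) h.2))

theorem cardNet_apply {K : Type*} [CommRing K] (X : LamS A) (l : FinL A) :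
    (cardNet hA K X).1 l = ((ext l.1 ∩ ext X.1).ncard : K) := by
  change ((ext (FinL.inter l X.1).1).ncard : K) = _
  rw [FinL.ext_inter]

theorem ext_LamS_single (a : Lam A) : ext (LamS.single hA a).1 = {a.1} := ext_single _

theorem ext_LamS_union (X Y : LamS A) :
    ext (LamS.union hA X Y).1 = ext X.1 ∪ ext Y.1 := ext_mkSet _

theorem ext_LamS_prod (X Y : LamS A) :
    ext (LamS.prod hA X Y).1 = Set.image2 opair (ext X.1) (ext Y.1) := ext_mkSet _

theorem ncard_inter_prod {l : FinL A} {X Y : LamS A}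
    (h : ∀ a ∈ ext X.1, ∀ b ∈ ext Y.1, opair a b ∈ ext l.1 ↔ a ∈ ext l.1 ∧ b ∈ ext l.1) :
    (ext l.1 ∩ ext (LamS.prod hA X Y).1).ncard =
      (ext l.1 ∩ ext X.1).ncard * (ext l.1 ∩ ext Y.1).ncard := by
  have e : ext l.1 ∩ ext (LamS.prod hA X Y).1 =
      (fun p : Obj A × Obj A => opair p.1 p.2) '' ((ext l.1 ∩ ext X.1) ×ˢ (ext l.1 ∩ ext Y.1)) := by
    rw [ext_LamS_prod]
    ext z
    constructor
    · rintro ⟨hz, a, ha, b, hb, rfl⟩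
      obtain ⟨h1, h2⟩ := (h a ha b hb).1 hz
      exact ⟨(a, b), ⟨⟨h1, ha⟩, ⟨h2, hb⟩⟩, rfl⟩
    · rintro ⟨⟨a, b⟩, ⟨⟨h1, ha⟩, ⟨h2, hb⟩⟩, rfl⟩
      exact ⟨(h a ha b hb).2 ⟨h1, h2⟩, a, ha, b, hb, rfl⟩
  rw [e, Set.ncard_image_of_injective _ fun p q hpq => Prod.ext_iff.2 (opair_injective hpq),
    Set.ncard_prod]

namespace Tower

variable (M : Tower hA r U)

theorem zero_lt_ord (hA : (Cardinal.mk A).IsInaccessible) : 0 < (Cardinal.mk A).ord := by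
  rw [Cardinal.lt_ord, Ordinal.card_zero]
  exact hA.pos

/-- The map `J_0`, as a ring homomorphism. -/
def hom₀ : Nets hA (M.K 0) →+* M.E :=
  (M.Θ 0 (zero_lt_ord hA)).comp (Ideal.Quotient.mk (nullIdeal hA U (M.K 0)))

/-- The counting nets are nets of real numbers, so that the numerosities are elements of `K_1`,
where the field operations and the order are those of the ultrapower. -/
theorem num_eq (X : LamS A) :
    M.num X = M.hom₀ (cardNet hA (M.K 0) X) :=
  M.J_eq 0 _ _ _ fun l => by
    rw [cardNet_apply, cardNet_apply]
    exact map_natCast (M.K 0).subtype _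

theorem num_le_iff (X Y : LamS A) : M.num X ≤ M.num Y ↔
    ∀ᶠ l in (U : Filter (FinL A)), (ext l.1 ∩ ext X.1).ncard ≤ (ext l.1 ∩ ext Y.1).ncard := by
  rw [num_eq, num_eq]
  refine (M.Θ_le_iff 0 (zero_lt_ord hA) _ _).trans ?_
  refine Filter.eventually_congr (.of_forall fun l => ?_)
  rw [cardNet_apply, cardNet_apply, Nat.cast_le]

/-- Nets that agree with the counting net almost everywhere also represent the numerosity. -/
theorem num_eq_map {X : LamS A} {φ : Nets hA (M.K 0)}
    (h : ∀ᶠ l in (U : Filter (FinL A)), ((ext l.1 ∩ ext X.1).ncard : M.K 0) = φ.1 l) :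
    M.num X = M.hom₀ φ := by
  rw [num_eq]
  refine congrArg (M.Θ 0 (zero_lt_ord hA)) (Ideal.Quotient.eq.2 ?_)
  filter_upwards [h] with l hl
  change (cardNet hA (M.K 0) X).1 l - φ.1 l = 0
  rw [cardNet_apply, hl, sub_self]

theorem num_union {X Y : LamS A} (h : Disjoint (ext X.1) (ext Y.1)) :
    M.num (LamS.union hA X Y) = M.num X + M.num Y := by
  rw [M.num_eq X, M.num_eq Y, ← map_add]
  refine M.num_eq_map (.of_forall fun l => ?_)
  change _ = (cardNet hA (M.K 0) X).1 l + (cardNet hA (M.K 0) Y).1 l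
  rw [cardNet_apply, cardNet_apply, ← Nat.cast_add, ext_LamS_union, Set.inter_union_distrib_left,
    Set.ncard_union_eq (h.mono Set.inter_subset_right Set.inter_subset_right)
      (l.2.2.subset Set.inter_subset_left) (l.2.2.subset Set.inter_subset_left)]

theorem num_prod (hU : Admissible U) (X Y : LamS A) :
    M.num (LamS.prod hA X Y) = M.num X * M.num Y := by
  rw [M.num_eq X, M.num_eq Y, ← map_mul]
  refine M.num_eq_map ?_
  filter_upwards [eventually_opair_mem_iff hA hU X Y] with l hl
  change _ = (cardNet hA (M.K 0) X).1 l * (cardNet hA (M.K 0) Y).1 l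
  rw [cardNet_apply, cardNet_apply, ← Nat.cast_mul, ncard_inter_prod hl]

theorem num_single (hU : Admissible U) (a : Lam A) : M.num (LamS.single hA a) = 1 := by
  rw [← map_one M.hom₀]
  refine M.num_eq_map ?_
  filter_upwards [eventually_mem hA hU a.2] with l hl
  change _ = (1 : M.K 0)
  rw [ext_LamS_single, Set.inter_eq_right.2 (Set.singleton_subset_iff.2 hl), Set.ncard_singleton,
    Nat.cast_one]

theorem num_lt (hU : Admissible U) {X Y : LamS A} (h : ext X.1 ⊂ ext Y.1) :
    M.num X < M.num Y := by
  obtain ⟨hXY, b, hbY, hbX⟩ := Set.ssubset_iff_exists.1 h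
  rw [← not_le, num_le_iff, ← Ultrafilter.eventually_not]
  obtain ⟨n, hn⟩ := Y.2.1.1
  filter_upwards [eventually_mem hA hU ⟨⟨n, ext_subset_V hn hbY⟩, Y.2.1.2.elem b hbY⟩]
    with l hl
  rw [not_le]
  exact Set.ncard_lt_ncard (Set.ssubset_iff_exists.2
    ⟨Set.inter_subset_inter_right _ hXY, b, ⟨hl, hbY⟩, fun h => hbX h.2⟩)
    (l.2.2.subset Set.inter_subset_left)

theorem numMap_eq_iff {X Y : LamS A} : M.numMap X = M.numMap Y ↔ M.num X = M.num Y :=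
  Subtype.ext_iff.trans (Subtype.ext_iff (a1 := M.num X) (a2 := M.num Y)).symm

theorem numerosityAxiom (hU : Admissible U) : NumerosityAxiom hA M.numMap where
  surjective := by
    rintro ⟨_, X, rfl⟩
    exact ⟨X, rfl⟩
  singleton a b := by rw [numMap_eq_iff, M.num_single hU, M.num_single hU]
  lt_of_ssubset X Y h := M.num_lt hU h
  union X Y X' Y' h h' := by
    rw [numMap_eq_iff, numMap_eq_iff, numMap_eq_iff, M.num_union h, M.num_union h']
    exact fun hX hY => by rw [hX, hY]
  prod X Y X' Y' := by
    rw [numMap_eq_iff, numMap_eq_iff, numMap_eq_iff, M.num_prod hU, M.num_prod hU]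
    exact fun hX hY => by rw [hX, hY]
  prod_singleton X b := by rw [numMap_eq_iff, M.num_prod hU, M.num_single hU, mul_one]

end Tower

end Numerosity

end EuclideanUniverse

theorem mainTheorem3 {A : Type u} (hA : (Cardinal.mk A).IsInaccessible) (r : ℝ ↪ A) :
    (∃ U : Ultrafilter (EuclideanUniverse.FinL A), EuclideanUniverse.Admissible U) ∧
    ∀ U : Ultrafilter (EuclideanUniverse.FinL A), EuclideanUniverse.Admissible U →
      Nonempty (EuclideanUniverse.Tower hA r U) ∧
      ∀ M : EuclideanUniverse.Tower hA r U,
        EuclideanUniverse.NumerosityAxiom hA M.numMap ∧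
        (∀ X Y : EuclideanUniverse.LamS A,
          Disjoint (EuclideanUniverse.ext X.1) (EuclideanUniverse.ext Y.1) →
            M.num (EuclideanUniverse.LamS.union hA X Y) = M.num X + M.num Y) ∧
        ∀ X Y : EuclideanUniverse.LamS A,
          M.num (EuclideanUniverse.LamS.prod hA X Y) = M.num X * M.num Y :=
  ⟨EuclideanUniverse.exists_admissible hA, fun _ hU => ⟨EuclideanUniverse.nonempty_tower,
    fun M => ⟨M.numerosityAxiom hU, fun _ _ => M.num_union, M.num_prod hU⟩⟩⟩
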